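/- Let $d_A,d_B,d_C,d_D$ be integers with $3\le d_A\le d_B\le d_C\le d_D$, and let $s$ be an integer with $0\le s\le\lfloor (d_A-3)/2\rfloor$. Then there exists a strongly nonlocal unextendible product basis $\mathcal U\subset\mathbb C^{d_A}\otimes\mathbb C^{d_B}\otimes\mathbb C^{d_C}\otimes\mathbb C^{d_D}$ with exactly $d_Ad_Bd_Cd_D-16(s+1)$ elements. Here states are nonzero vectors, not necessarily normalized. An unextendible product basis is a finite set of mutually orthogonal product states $|a\rangle|b\rangle|c\rangle|e\rangle$ which does not span the whole space and such that the orthogonal complement of its span contains no product state. Such a set is strongly nonlocal if it is locally irreducible in each of the seven bipartitions of the parties $A,B,C,D$ into two nonempty groups. Locally irreducible in a bipartition means that it is impossible to eliminate one or more (but not all) of the states by a finite sequence of orthogonality-preserving local measurements, possibly chosen adaptively, where each measurement is performed by one of the two groups acting jointly. A local measurement by a group consists of finitely many operators $M_k$ on the joint space of that group with $\sum_k M_k^\dagger M_k=\mathbb I$, and it takes each state $|\psi\rangle$ to $(M_k\otimes\mathbb I)|\psi\rangle$ on outcome $k$. It is orthogonality-preserving if for each $k$ the postmeasurement vectors of distinct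 states are orthogonal. A state is eliminated by an outcome if its postmeasurement vector is zero while that of some other state is not. -/

import Mathlib

/-- The (not necessarily normalized) vectors of the multipartite system `⨂ i, ℂ^(d i)`, written in
the computational basis, whose elements are the tuples `x` with `x i ∈ {0, …, d i - 1}`. -/
abbrev MState {ι : Type} (d : ι → ℕ) : Type :=
  EuclideanSpace ℂ ((i : ι) → Fin (d i))

/-- A (pure, fully) product state: a nonzero vector of the form `⨂ i, v i`. -/
def IsProductState {ι : Type} [Fintype ι] {d : ι → ℕ} (ψ : MState d) : Prop :=
  ψ ≠ 0 ∧ ∃ v : (i : ι) → EuclideanSpace ℂ (Fin (d i)), ∀ x, ψ x = ∏ i, v i (x i)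

/-- An orthogonal product set: a finite set of mutually orthogonal product states. -/
def IsOPS {ι : Type} [Fintype ι] [DecidableEq ι] {d : ι → ℕ} (U : Finset (MState d)) : Prop :=
  (∀ ψ ∈ U, IsProductState ψ) ∧ ∀ ψ ∈ U, ∀ φ ∈ U, ψ ≠ φ → inner ℂ ψ φ = 0

/-- An unextendible product basis: an orthogonal product set which does not span the whole space
and whose complementary subspace contains no product state. -/
def IsUPB {ι : Type} [Fintype ι] [DecidableEq ι] {d : ι → ℕ} (U : Finset (MState d)) : Prop :=
  IsOPS U ∧
  Submodule.span ℂ (U : Set (MState d)) ≠ ⊤ ∧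
  ∀ φ ∈ (Submodule.span ℂ (U : Set (MState d)))ᗮ, ¬ IsProductState φ

/-- Operators on the joint system `⨂ i ∈ P, ℂ^(d i)` of the parties in `P`. -/
abbrev GroupOp {ι : Type} (d : ι → ℕ) (P : Finset ι) : Type :=
  Matrix ((i : {i // i ∈ P}) → Fin (d i)) ((i : {i // i ∈ P}) → Fin (d i)) ℂ

/-- The operator `M ⊗ 𝟙` applied to `ψ`, where `M` acts on the parties in `P` and the identity on
all other parties. -/
noncomputable def applyOn {ι : Type} [Fintype ι] [DecidableEq ι] {d : ι → ℕ} {P : Finset ι}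
    (M : GroupOp d P) (ψ : MState d) : MState d :=
  WithLp.toLp 2 fun x =>
    ∑ y : (i : {i // i ∈ P}) → Fin (d i),
      M (fun i => x i) y * ψ (fun i => if h : i ∈ P then y ⟨i, h⟩ else x i)

/-- A measurement by the parties in `P` acting together: finitely many operators `M k` whose
POVM elements `(M k)ᴴ * M k` add up to the identity. -/
def IsMeasurement {ι : Type} [DecidableEq ι] {d : ι → ℕ} {P : Finset ι} {m : ℕ}
    (M : Fin m → GroupOp d P) : Prop :=
  ∑ k, (M k).conjTranspose * M k = 1

/-- The measurement `M` keeps the states `ψ i` mutually orthogonal, whatever the outcome. -/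
def PreservesOrthogonality {κ ι : Type} [Fintype ι] [DecidableEq ι] {d : ι → ℕ}
    {P : Finset ι} {m : ℕ} (M : Fin m → GroupOp d P) (ψ : κ → MState d) : Prop :=
  ∀ k i j, i ≠ j → inner ℂ (applyOn (M k) (ψ i)) (applyOn (M k) (ψ j)) = 0

/-- One or more (but not all) of the states `ψ i` can be eliminated by finitely many successive
orthogonality-preserving local measurements, each made by one of the two sides of the bipartition
`T | Tᶜ`, where the later measurements may depend on the earlier outcomes. An outcome whose
operator annihilates all the states never occurs and is disregarded. -/
inductive CanEliminate {κ ι : Type} [Fintype ι] [DecidableEq ι] {d : ι → ℕ} (T : Finset ι) :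
    (κ → MState d) → Prop
  | now {ψ : κ → MState d} (P : Finset ι) (hP : P = T ∨ P = Tᶜ) {m : ℕ}
      (M : Fin m → GroupOp d P) (hM : IsMeasurement M) (hO : PreservesOrthogonality M ψ)
      (k : Fin m) (i j : κ) (hi : applyOn (M k) (ψ i) = 0) (hj : applyOn (M k) (ψ j) ≠ 0) :
      CanEliminate T ψ
  | later {ψ : κ → MState d} (P : Finset ι) (hP : P = T ∨ P = Tᶜ) {m : ℕ}
      (M : Fin m → GroupOp d P) (hM : IsMeasurement M) (hO : PreservesOrthogonality M ψ)
      (k : Fin m) (j : κ) (hj : applyOn (M k) (ψ j) ≠ 0)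
      (h : CanEliminate T fun i => applyOn (M k) (ψ i)) :
      CanEliminate T ψ

/-- `U` is locally irreducible in the bipartition `T | Tᶜ`: no state of `U` can be eliminated by
orthogonality-preserving local measurements of the two sides. -/
def IsLocallyIrreducible {ι : Type} [Fintype ι] [DecidableEq ι] {d : ι → ℕ} (T : Finset ι)
    (U : Finset (MState d)) : Prop :=
  ¬ CanEliminate T fun ψ : {ψ // ψ ∈ U} => ψ.1

/-- `U` is strongly nonlocal: locally irreducible in every bipartition of the set of parties into
two nonempty groups. -/
def IsStronglyNonlocal {ι : Type} [Fintype ι] [DecidableEq ι] {d : ι → ℕ}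
    (U : Finset (MState d)) : Prop :=
  ∀ T : Finset ι, T.Nonempty → Tᶜ.Nonempty → IsLocallyIrreducible T U

/-!
Peel the set of index tuples into `s + 1` layers, where the `l`-th layer consists of the tuples with
minimal distance `l` of a coordinate to the ends of its line. Each layer falls into sixteen boxes,
one for each corner, and an interior box remains. The basis consists of the nontrivial characters of
all boxes, for any group structure on their sides, and of the all-ones stopper: among the
`∏ j, d j` characters, the trivial ones of the `16 * (s + 1) + 1` boxes are replaced by one state.

A product vector orthogonal to all characters is constant on every box. On the outermost layer that
it meets, the boxes link the four parties cyclically, and going around this cycle shows that each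
factor has a nonzero sum, so that the vector is not orthogonal to the stopper.

For strong nonlocality, a side of a bipartition misses some party `i`, so a measurement operator `M`
of this side yields a matrix `Mᴴ * M` acting as `1 ⊗ E` with `E` on the parties other than `i`. By
Fourier inversion, preservation of orthogonality means that the entries of `1 ⊗ E` have the form
`v x + u y` between two boxes and `k (x - y) + v x + u y` on a single box, and that column sums are
constant on boxes. The blocks of the outermost layer overlap enough, once projected to the parties
other than `i`, to force `E` to be scalar. Hence `M` is a multiple of an isometry, which annihilates
no single state and passes this rigidity on to the states after the measurement.
-/

open Finset Matrix
open scoped Kronecker ComplexOrder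

section Fourier

variable {G H : Type*} [AddCommGroup G] [Fintype G] [AddCommGroup H] [Fintype H]

theorem eq_of_forall_char_dotProduct_eq_zero {g : G → ℂ}
    (hg : ∀ χ : AddChar G ℂ, χ ≠ 0 → g ⬝ᵥ χ = 0) (x y : G) : g x = g y := by
  classical
  have inversion : ∀ z, (Fintype.card G : ℂ) * g z = ∑ w, g w := by
    intro z
    calc (Fintype.card G : ℂ) * g z
        = ∑ w, g w * ∑ χ : AddChar G ℂ, χ (w - z) := by
          simp [AddChar.sum_apply_eq_ite, sub_eq_zero, mul_comm]
      _ = ∑ χ : AddChar G ℂ, χ (-z) * (g ⬝ᵥ χ) := by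
          simp only [dotProduct, Finset.mul_sum]
          rw [Finset.sum_comm]
          simp only [sub_eq_add_neg, AddChar.map_add_eq_mul, mul_comm, mul_left_comm]
      _ = ∑ w, g w := by
          rw [Finset.sum_eq_single 0 (fun χ _ hχ => by rw [hg χ hχ, mul_zero]) (by simp)]
          simp [dotProduct]
  exact mul_left_cancel₀ (Nat.cast_ne_zero.2 Fintype.card_ne_zero)
    ((inversion x).trans (inversion y).symm)

theorem star_char (χ : AddChar G ℂ) : star (χ : G → ℂ) = (χ⁻¹ : AddChar G ℂ) := by
  ext x
  rw [AddChar.inv_apply, AddChar.map_neg_eq_conj]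
  rfl

theorem eq_of_forall_star_char_dotProduct_eq_zero {g : G → ℂ}
    (hg : ∀ χ : AddChar G ℂ, χ ≠ 0 → star (χ : G → ℂ) ⬝ᵥ g = 0) (x y : G) : g x = g y := by
  refine eq_of_forall_char_dotProduct_eq_zero (fun χ hχ => ?_) x y
  rw [dotProduct_comm]
  simpa only [star_char, inv_inv] using hg χ⁻¹ (inv_ne_one.2 hχ)

theorem exists_eq_add_of_forall_char {F : Matrix G H ℂ}
    (hF : ∀ (χ : AddChar G ℂ) (ξ : AddChar H ℂ), χ ≠ 0 → ξ ≠ 0 →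
      star (χ : G → ℂ) ⬝ᵥ F *ᵥ ξ = 0) :
    ∃ (v : G → ℂ) (u : H → ℂ), ∀ x y, F x y = v x + u y := by
  have cross : ∀ x x' y y', F x y - F x' y = F x y' - F x' y' := by
    intro x x' y y'
    refine eq_of_forall_char_dotProduct_eq_zero (g := fun y => F x y - F x' y) (fun ξ hξ => ?_) y y'
    have hconst := eq_of_forall_star_char_dotProduct_eq_zero (g := F *ᵥ ξ)
      (fun χ hχ => hF χ ξ hχ hξ) x x'
    simp only [mulVec, dotProduct] at hconst ⊢
    simp only [sub_mul, Finset.sum_sub_distrib, hconst, sub_self]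
  refine ⟨fun x => F x 0, fun y => F 0 y - F 0 0, fun x y => ?_⟩
  linear_combination cross x 0 y 0

theorem star_char_dotProduct_translate_mulVec (F : Matrix G G ℂ) (h : G) (χ ξ : AddChar G ℂ) :
    star (χ : G → ℂ) ⬝ᵥ (F.submatrix (· + h) (· + h)) *ᵥ ξ =
      χ h * ξ (-h) * (star (χ : G → ℂ) ⬝ᵥ F *ᵥ ξ) := by
  have shift : ∀ g : G → ℂ, ∑ x, g x = ∑ x, g (x + h) := fun g =>
    (Equiv.sum_comp (Equiv.addRight h) g).symm
  simp only [star_char, dotProduct, mulVec, submatrix_apply, AddChar.inv_apply, Finset.mul_sum]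
  rw [shift fun x => ∑ y, χ h * ξ (-h) * (χ (-x) * (F x y * ξ y))]
  refine Finset.sum_congr rfl fun x _ => ?_
  rw [shift fun y => χ h * ξ (-h) * (χ (-(x + h)) * (F (x + h) y * ξ y))]
  refine Finset.sum_congr rfl fun y _ => ?_
  have hχ : χ h * χ (-h) = 1 := by rw [← AddChar.map_add_eq_mul]; simp
  have hξ : ξ (-h) * ξ h = 1 := by rw [← AddChar.map_add_eq_mul]; simp
  rw [neg_add, AddChar.map_add_eq_mul, AddChar.map_add_eq_mul]
  linear_combination (-χ (-x) * F (x + h) (y + h) * ξ y) * hχ -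
    (χ h * χ (-h) * χ (-x) * F (x + h) (y + h) * ξ y) * hξ

theorem exists_translate_sub_eq_add {F : Matrix G G ℂ}
    (hF : ∀ χ ξ : AddChar G ℂ, χ ≠ 0 → ξ ≠ 0 → χ ≠ ξ → star (χ : G → ℂ) ⬝ᵥ F *ᵥ ξ = 0)
    (h : G) : ∃ v u : G → ℂ, ∀ x y, F (x + h) (y + h) - F x y = v x + u y := by
  refine exists_eq_add_of_forall_char (F := F.submatrix (· + h) (· + h) - F) fun χ ξ hχ hξ => ?_
  rw [sub_mulVec, dotProduct_sub, star_char_dotProduct_translate_mulVec]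
  obtain rfl | hne := eq_or_ne χ ξ
  · rw [← AddChar.map_add_eq_mul, add_neg_cancel, AddChar.map_zero_eq_one, one_mul, sub_self]
  · rw [hF χ ξ hχ hξ hne, mul_zero, sub_zero]

/-- Subtracting its row and column means makes `F` invariant under simultaneous translation. -/
theorem exists_eq_convolution_add_of_forall_char {F : Matrix G G ℂ}
    (hF : ∀ χ ξ : AddChar G ℂ, χ ≠ 0 → ξ ≠ 0 → χ ≠ ξ → star (χ : G → ℂ) ⬝ᵥ F *ᵥ ξ = 0) :
    ∃ k v u : G → ℂ, ∀ x y, F x y = k (x - y) + v x + u y := by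
  set n : ℂ := (Fintype.card G : ℂ)
  have hn : n ≠ 0 := Nat.cast_ne_zero.2 Fintype.card_ne_zero
  let row x := n⁻¹ * ∑ y, F x y
  let col y := n⁻¹ * ∑ x, F x y
  have invariant : ∀ h x y, F (x + h) (y + h) - row (x + h) - col (y + h) =
      F x y - row x - col y := by
    intro h x y
    obtain ⟨v, u, hvu⟩ := exists_translate_sub_eq_add hF h
    have shift : ∀ g : G → ℂ, ∑ x, g (x + h) = ∑ x, g x := Equiv.sum_comp (Equiv.addRight h)
    have hrow : ∀ x, ∑ y, F (x + h) y - ∑ y, F x y = n * v x + ∑ y, u y := fun x => by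
      rw [← shift, ← Finset.sum_sub_distrib]
      simp [hvu, Finset.sum_add_distrib, n]
    have hcol : ∀ y, ∑ x, F x (y + h) - ∑ x, F x y = ∑ x, v x + n * u y := fun y => by
      rw [← shift, ← Finset.sum_sub_distrib]
      simp [hvu, Finset.sum_add_distrib, n]
    have htotal : n * (∑ x, v x + ∑ y, u y) = 0 := by
      have := Finset.sum_congr rfl fun x (_ : x ∈ univ) => hrow x
      rw [Finset.sum_sub_distrib, shift fun x => ∑ y, F x y, sub_self, Finset.sum_add_distrib,
        ← Finset.mul_sum, Finset.sum_const, Finset.card_univ, nsmul_eq_mul] at this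
      linear_combination -this
    have hmean := (mul_eq_zero.1 htotal).resolve_left hn
    simp only [row, col]
    linear_combination hvu x y - n⁻¹ * hrow x - n⁻¹ * hcol y - n⁻¹ * hmean +
      (-v x - u y) * (mul_inv_cancel₀ hn)
  refine ⟨fun g => F g 0 - row g - col 0, row, col, fun x y => ?_⟩
  have := invariant y (x - y) 0
  rw [sub_add_cancel, zero_add] at this
  linear_combination this

end Fourier

section Convolution

variable {G C : Type*} [AddCommGroup G] [Finite G] [AddCommGroup C] {k v u : G → ℂ}

theorem right_eq_of_convolution_add_eq_zero (h : ∀ x y, k (x - y) + v x + u y = 0) (y y' : G) :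
    u y = u y' := by
  cases nonempty_fintype G
  have hsum : ∀ y, ∑ x, k x + ∑ x, v x + (Fintype.card G : ℂ) * u y = 0 := fun y => by
    rw [← Equiv.sum_comp (Equiv.subRight y) k, ← nsmul_eq_mul, ← Finset.card_univ,
      ← Finset.sum_const, ← Finset.sum_add_distrib, ← Finset.sum_add_distrib]
    exact Finset.sum_eq_zero fun x _ => h x y
  refine mul_left_cancel₀ (Nat.cast_ne_zero.2 (Fintype.card_ne_zero (α := G))) ?_
  linear_combination hsum y - hsum y'

theorem left_eq_of_convolution_add_eq_zero (h : ∀ x y, k (x - y) + v x + u y = 0) (x x' : G) :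
    v x = v x' := by
  refine right_eq_of_convolution_add_eq_zero (k := fun g => k (-g)) (v := u) (fun x y => ?_) x x'
  rw [neg_sub, add_right_comm, h]

theorem eq_on_fibers_of_convolution_add_eq_zero (π : G →+ C) {x₀ y₀ : G}
    (h : ∀ x y, π x = π x₀ → π y = π y₀ → k (x - y) + v x + u y = 0) :
    (∀ x, π x = π x₀ → v x = v x₀) ∧ ∀ y, π y = π y₀ → u y = u y₀ := by
  classical
  have hker : ∀ a b : π.ker, k (x₀ - y₀ + ↑(a - b)) + v (x₀ + a) + u (y₀ + b) = 0 := fun a b => by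
    have := h (x₀ + a) (y₀ + b) (by simp [AddMonoidHom.mem_ker.1 a.2])
      (by simp [AddMonoidHom.mem_ker.1 b.2])
    rwa [add_sub_add_comm] at this
  constructor
  · intro x hx
    simpa using left_eq_of_convolution_add_eq_zero (k := fun g : π.ker => k (x₀ - y₀ + g))
      (v := fun a => v (x₀ + a)) (u := fun b => u (y₀ + b)) hker ⟨x - x₀, by simp [hx]⟩ 0
  · intro y hy
    simpa using right_eq_of_convolution_add_eq_zero (k := fun g : π.ker => k (x₀ - y₀ + g))
      (v := fun a => v (x₀ + a)) (u := fun b => u (y₀ + b)) hker ⟨y - y₀, by simp [hy]⟩ 0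

variable {F : Matrix G G ℂ} (hF : ∀ x y, F x y = k (x - y) + v x + u y) (π : G →+ C) {c₀ : C}
  (hleft : ∀ x y, π x = c₀ → π y ≠ c₀ → F x y = 0)
  (hright : ∀ x y, π x ≠ c₀ → π y = c₀ → F x y = 0)
include hF hleft hright

theorem eq_on_fibers_of_slice_decoupled {x₀ x₁ : G} (h₀ : π x₀ = c₀) (h₁ : π x₁ ≠ c₀) {x x' : G}
    (hx : π x = π x') : v x = v x' ∧ u x = u x' := by
  have vanish : ∀ {a b}, (π a = c₀ ↔ π b ≠ c₀) →
      (∀ x, π x = π a → v x = v a) ∧ ∀ y, π y = π b → u y = u b := fun {a b} hab => by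
    refine eq_on_fibers_of_convolution_add_eq_zero π (k := k) fun x y hxa hyb => ?_
    rw [← hF]
    by_cases ha : π a = c₀
    · exact hleft x y (hxa.trans ha) (hyb ▸ hab.1 ha)
    · exact hright x y (hxa ▸ ha) (hyb.trans (not_not.1 fun hb => ha (hab.2 hb)))
  by_cases h : π x' = c₀
  · exact ⟨(vanish (b := x₁) (by simp [h, h₁])).1 x hx,
      (vanish (a := x₁) (by simp [h, h₁])).2 x hx⟩
  · exact ⟨(vanish (b := x₀) (by simp [h, h₀])).1 x hx,
      (vanish (a := x₀) (by simp [h, h₀])).2 x hx⟩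

/-- Every nonzero difference of fibers also occurs between the slice `π = c₀` and another fiber,
where `F` vanishes. -/
theorem eq_of_slice_decoupled {x₀ : G} (h₀ : π x₀ = c₀) {x y x' y' : G}
    (hxy : π x ≠ π y) (hx : π x' = π x) (hy : π y' = π y) : F x' y' = F x y := by
  have hne : ∀ {g}, π g = π (x - y) → π (x₀ + g) ≠ c₀ := fun hg => by
    rwa [map_add, h₀, hg, map_sub, Ne, add_eq_left, sub_eq_zero]
  have fiber {a b} (hab : π a = π b) :=
    eq_on_fibers_of_slice_decoupled hF π hleft hright h₀ (hne rfl) hab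
  have hk : k (x' - y') = k (x - y) := by
    have hg : π (x' - y') = π (x - y) := by rw [map_sub, map_sub, hx, hy]
    have e := hright (x₀ + (x - y)) x₀ (hne rfl) h₀
    have e' := hright (x₀ + (x' - y')) x₀ (hne hg) h₀
    rw [hF, add_sub_cancel_left] at e e'
    linear_combination e' - e -
      (fiber (a := x₀ + (x' - y')) (b := x₀ + (x - y)) (by rw [map_add, map_add, hg])).1
  rw [hF, hF, hk, (fiber hx).1, (fiber hy).2]

/-- The part of the matrix outside a decoupled slice is killed by one zero for each pair of fibers
(and each difference, within a fiber); the common value of `k` on the kernel of `π` then also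
governs the slice. -/
theorem eq_zero_or_mem_slice_of_convolution_add (hslice : ∃ x, π x = c₀)
    (hdiag : ∃ x, π x ≠ c₀ ∧ F x x = 0) (hker : ∃ g ≠ 0, π g = 0)
    (hzero : ∀ x y, x ≠ y → π x ≠ c₀ → π y ≠ c₀ →
      ∃ x' y', π x' = π x ∧ π y' = π y ∧ (π x = π y → x' - y' = x - y) ∧ F x' y' = 0) :
    (∀ x y, π x ≠ c₀ → π y ≠ c₀ → F x y = 0) ∧ ∃ r, ∀ x y, π x = c₀ → π y = c₀ → F x y = r := by
  obtain ⟨x₀, h₀⟩ := hslice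
  obtain ⟨x₁, h₁, hx₁⟩ := hdiag
  have fiber {a b} (hab : π a = π b) :=
    eq_on_fibers_of_slice_decoupled hF π hleft hright h₀ h₁ hab
  have offDiag : ∀ g ≠ 0, π g = 0 → ∀ x, π x ≠ c₀ → k g + v x + u x = 0 := by
    intro g hg hπ x hx
    have hgx : π (x + g) = π x := by rw [map_add, hπ, add_zero]
    obtain ⟨x', y', hx', hy', hsub, h⟩ := hzero (x + g) x (by simpa using hg) (hgx ▸ hx) hx
    rwa [hF, hsub hgx, add_sub_cancel_left, (fiber (hx'.trans hgx)).1, (fiber hy').2] at h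
  obtain ⟨g₀, hg₀, hπ₀⟩ := hker
  have onKer : ∀ g, π g = 0 → ∀ x, π x ≠ c₀ → k g + v x + u x = 0 := by
    intro g hπ x hx
    obtain rfl | hg := eq_or_ne g 0
    · rw [hF, sub_self] at hx₁
      linear_combination hx₁ + offDiag g₀ hg₀ hπ₀ x hx - offDiag g₀ hg₀ hπ₀ x₁ h₁
    · exact offDiag g hg hπ x hx
  constructor
  · intro x y hx hy
    by_cases hxy : π x = π y
    · rw [hF, ← (fiber hxy).2]
      exact onKer (x - y) (by rw [map_sub, hxy, sub_self]) x hx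
    · obtain ⟨x', y', hx', hy', -, h⟩ := hzero x y (fun h => hxy (congrArg π h)) hx hy
      rw [← eq_of_slice_decoupled hF π hleft hright h₀ hxy hx' hy', h]
  · refine ⟨v x₀ + u x₀ - v x₁ - u x₁, fun x y hx hy => ?_⟩
    rw [hF, (fiber (hx.trans h₀.symm)).1, (fiber (hy.trans h₀.symm)).2]
    linear_combination onKer (x - y) (by rw [map_sub, hx, hy, sub_self]) x₁ h₁

end Convolution

section Kronecker

variable {A P : Type*} [DecidableEq A] {E : Matrix P P ℂ}

theorem eq_zero_of_one_kronecker_eq_add {S S' : Set A} {R R' : Set P} {v u : A × P → ℂ}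
    (h : ∀ a ∈ S, ∀ p ∈ R, ∀ a' ∈ S', ∀ q ∈ R',
      ((1 : Matrix A A ℂ) ⊗ₖ E) (a, p) (a', q) = v (a, p) + u (a', q))
    {a₀ a₁ a₂ : A} (h₀ : a₀ ∈ S) (h₀' : a₀ ∈ S') (h₁ : a₁ ∈ S) (h₂ : a₂ ∈ S') (h₁₀ : a₁ ≠ a₀)
    (h₂₀ : a₂ ≠ a₀) {p q : P} (hp : p ∈ R) (hq : q ∈ R') : E p q = 0 := by
  have e₀₀ := h a₀ h₀ p hp a₀ h₀' q hq
  have e₀₂ := h a₀ h₀ p hp a₂ h₂ q hq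
  have e₁₀ := h a₁ h₁ p hp a₀ h₀' q hq
  have e₁₂ := h a₁ h₁ p hp a₂ h₂ q hq
  simp only [kroneckerMap_apply, one_apply, if_true, h₁₀, h₂₀.symm, if_false, one_mul,
    zero_mul] at e₀₀ e₀₂ e₁₀ e₁₂
  split_ifs at e₁₂
  · linear_combination (e₀₀ + e₁₂ - e₀₂ - e₁₀) / 2
  · linear_combination e₀₀ + e₁₂ - e₀₂ - e₁₀

theorem left_eq_of_one_kronecker_eq_add {S S' : Set A} {R R' : Set P} {v u : A × P → ℂ}
    (h : ∀ a ∈ S, ∀ p ∈ R, ∀ a' ∈ S', ∀ q ∈ R',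
      ((1 : Matrix A A ℂ) ⊗ₖ E) (a, p) (a', q) = v (a, p) + u (a', q))
    {a₀ a₁ : A} (h₀ : a₀ ∈ S) (h₀' : a₀ ∈ S') (h₁ : a₁ ∈ S') (h₁₀ : a₁ ≠ a₀)
    {p p' q : P} (hp : p ∈ R) (hp' : p' ∈ R) (hq : q ∈ R') : E p q = E p' q := by
  have e₀ := h a₀ h₀ p hp a₀ h₀' q hq
  have e₀' := h a₀ h₀ p' hp' a₀ h₀' q hq
  have e₁ := h a₀ h₀ p hp a₁ h₁ q hq
  have e₁' := h a₀ h₀ p' hp' a₁ h₁ q hq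
  simp only [kroneckerMap_apply, one_apply, if_true, h₁₀.symm, if_false, one_mul,
    zero_mul] at e₀ e₀' e₁ e₁'
  linear_combination e₀ - e₀' - e₁ + e₁'

theorem right_eq_of_one_kronecker_eq_add {S S' : Set A} {R R' : Set P} {v u : A × P → ℂ}
    (h : ∀ a ∈ S, ∀ p ∈ R, ∀ a' ∈ S', ∀ q ∈ R',
      ((1 : Matrix A A ℂ) ⊗ₖ E) (a, p) (a', q) = v (a, p) + u (a', q))
    {a₀ a₁ : A} (h₀ : a₀ ∈ S) (h₀' : a₀ ∈ S') (h₁ : a₁ ∈ S) (h₁₀ : a₁ ≠ a₀)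
    {p q q' : P} (hp : p ∈ R) (hq : q ∈ R') (hq' : q' ∈ R') : E p q = E p q' := by
  refine left_eq_of_one_kronecker_eq_add (E := Eᵀ) (S := S') (S' := S) (v := u) (u := v)
    (fun a ha p hp a' ha' q hq => ?_) h₀' h₀ h₁ h₁₀ hq hq' hp
  rw [add_comm, ← h a' ha' q hq a ha p hp]
  simp only [kroneckerMap_apply, one_apply, transpose_apply, eq_comm]

theorem sub_eq_sub_of_one_kronecker_eq_add {S S' : Set A} {R R' : Set P} {v u : A × P → ℂ}
    (h : ∀ a ∈ S, ∀ p ∈ R, ∀ a' ∈ S', ∀ q ∈ R',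
      ((1 : Matrix A A ℂ) ⊗ₖ E) (a, p) (a', q) = v (a, p) + u (a', q))
    {a : A} (ha : a ∈ S) (ha' : a ∈ S') {p p' q q' : P} (hp : p ∈ R) (hp' : p' ∈ R)
    (hq : q ∈ R') (hq' : q' ∈ R') : E p q - E p' q = E p q' - E p' q' := by
  have e := h a ha p hp a ha' q hq
  have e₁ := h a ha p' hp' a ha' q hq
  have e₂ := h a ha p hp a ha' q' hq'
  have e₃ := h a ha p' hp' a ha' q' hq'
  simp only [kroneckerMap_apply, one_apply, if_true, one_mul] at e e₁ e₂ e₃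
  linear_combination e - e₁ - e₂ + e₃

theorem translate_eq_of_one_kronecker_eq_convolution_add {G H : Type*} [AddCommGroup G]
    [DecidableEq G] [Nontrivial G] [AddCommGroup H] [Finite H] {E : Matrix H H ℂ}
    {k v u : G × H → ℂ}
    (h : ∀ p q, ((1 : Matrix G G ℂ) ⊗ₖ E) p q = k (p - q) + v p + u q) (x y z : H) :
    E (x + z) (y + z) = E x y := by
  obtain ⟨g, hg⟩ := exists_ne (0 : G)
  have off : ∀ a a', a ≠ a' → ∀ x y, k (a - a', x - y) + v (a, x) + u (a', y) = 0 :=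
    fun a a' hne x y => by simpa [kroneckerMap_apply, one_apply, hne] using (h (a, x) (a', y)).symm
  have hv := left_eq_of_convolution_add_eq_zero (k := fun z => k (0 - g, z))
    (v := fun x => v (0, x)) (u := fun y => u (g, y)) (off 0 g hg.symm) (x + z) x
  have hu := right_eq_of_convolution_add_eq_zero (k := fun z => k (g - 0, z))
    (v := fun x => v (g, x)) (u := fun y => u (0, y)) (off g 0 hg) (y + z) y
  have e := h (0, x) (0, y)
  have e' := h (0, x + z) (0, y + z)
  simp only [kroneckerMap_apply, one_apply, if_true, one_mul, Prod.mk_sub_mk,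
    add_sub_add_right_eq_sub] at e e'
  linear_combination e' - e + hv + hu

end Kronecker

section Sides

variable {X : Type*}

/-- `τ` types the points of a line: `some false` and `some true` are its two end points, and `none`
are the points between them. -/
class IsEndTyping (τ : X → Option Bool) : Prop where
  surjective : Function.Surjective τ
  eq_of_eq_some : ∀ {x y b}, τ x = some b → τ y = some b → x = y

/-- Whether a point of type `t` belongs to the side which contains the end `c` and, if `ext` holds,
all the points between the ends. -/
def fits (t : Option Bool) (c ext : Bool) : Bool :=
  t == some c || (ext && t.isNone)

/-- The side of a block along a typed line: the end `c`, together with the points between the ends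
if `ext` holds. -/
def side [Fintype X] (τ : X → Option Bool) (c ext : Bool) : Finset X :=
  univ.filter fun x => fits (τ x) c ext

@[simp]
theorem mem_side [Fintype X] {τ : X → Option Bool} {c ext : Bool} {x : X} :
    x ∈ side τ c ext ↔ fits (τ x) c ext := by
  simp [side]

instance nonempty_side [Fintype X] (τ : X → Option Bool) [IsEndTyping τ] (c ext : Bool) :
    Nonempty (side τ c ext) :=
  let ⟨x, hx⟩ := IsEndTyping.surjective (τ := τ) (some c)
  ⟨x, by simp [hx, fits]⟩

theorem eq_none_of_mem_side [Fintype X] {τ : X → Option Bool} {c ext : Bool} (x : side τ c ext)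
    (hx : τ x ≠ some c) : τ x = none := by
  have := mem_side.1 x.2
  simp only [fits, beq_eq_false_iff_ne.2 hx, Bool.false_or, Bool.and_eq_true] at this
  exact Option.isNone_iff_eq_none.1 this.2

theorem exists_mem_side [Fintype X] (τ : X → Option Bool) [IsEndTyping τ] {t : Option Bool}
    {c ext : Bool} (h : fits t c ext) : ∃ x : side τ c ext, τ x = t :=
  let ⟨x, hx⟩ := IsEndTyping.surjective (τ := τ) t
  ⟨⟨x, by simpa [hx]⟩, hx⟩

theorem eq_iff_of_mem_side [Fintype X] {τ : X → Option Bool} [IsEndTyping τ] {c ext : Bool}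
    {x y : side τ c ext} (hy : τ y = some c) : x = y ↔ τ x = some c :=
  ⟨fun h => h ▸ hy, fun h => Subtype.ext (IsEndTyping.eq_of_eq_some h hy)⟩

/-- A cyclic group structure on a nonempty finite set. Only its existence matters: the states of a
block are the characters of the product of the groups on its sides. -/
noncomputable instance addCommGroupOfNonempty (S : Finset X) [Nonempty S] : AddCommGroup S :=
  have : NeZero (Fintype.card S) := ⟨Fintype.card_ne_zero⟩
  ((Fintype.equivFin S).trans (ZMod.finEquiv _).toEquiv).addCommGroup

end Sides

section ConstantOnSupport

theorem eq_zero_of_const_on_support {ι : Type*} [Fintype ι] {f : ι → ℂ} {S : Set ι}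
    (hconst : ∀ i ∈ S, ∀ j ∈ S, f i = f j) (hzero : ∀ i ∉ S, f i = 0) (hsum : ∑ i, f i = 0)
    (i : ι) : f i = 0 := by
  classical
  by_cases hi : i ∈ S
  · have hsum' : ∑ j, f j = (#{j | j ∈ S} : ℂ) * f i := by
      rw [← Finset.sum_filter_add_sum_filter_not univ (· ∈ S), Finset.sum_congr rfl
        fun j hj => hconst j (mem_filter.1 hj).2 i hi, Finset.sum_const, nsmul_eq_mul,
        Finset.sum_eq_zero fun j hj => hzero j (mem_filter.1 hj).2, add_zero]
    refine (mul_eq_zero.1 (hsum'.symm.trans hsum)).resolve_left (Nat.cast_ne_zero.2 ?_)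
    exact (card_pos.2 ⟨i, by simpa⟩).ne'
  · exact hzero i hi

theorem sum_ne_zero_of_const {ι : Type*} [Fintype ι] {f : ι → ℂ} {k : ℂ} (hf : f ≠ 0)
    (h : ∀ x, f x ≠ 0 → f x = k) : ∑ x, f x ≠ 0 := fun hsum =>
  hf <| funext fun x => eq_zero_of_const_on_support (S := {x | f x ≠ 0})
    (fun x hx y hy => (h x hx).trans (h y hy).symm) (fun _ => not_not.1) hsum x

end ConstantOnSupport

section OuterLayer

variable {A B C D : Type*} [Fintype A] [DecidableEq A] [Fintype B] [Fintype C] [Fintype D]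
  {τA : A → Option Bool} {τB : B → Option Bool} {τC : C → Option Bool} {τD : D → Option Bool}

/-- The type of a cell of the last three parties. -/
abbrev CellType : Type := Option Bool × Option Bool × Option Bool

/-- Whether a cell of type `t` lies in the projection to the last three parties of the block of the
outer layer whose corner is `(!f, b, c, e)`: the side of a party is extended when its end differs
from the next one, and the corner of the fourth party is followed by the flipped first one. -/
def tailFits (b c e f : Bool) (t : CellType) : Bool :=
  fits t.1 b (xor b c) && fits t.2.1 c (xor c e) && fits t.2.2 e (xor e f)

variable (τB τC τD) in
/-- The type of a cell. -/
def cellType (p : B × C × D) : CellType := (τB p.1, τC p.2.1, τD p.2.2)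

variable (τB τC τD) in
/-- The projection to the last three parties of the block with corner `(!f, b, c, e)`. -/
def tailBox (b c e f : Bool) : Set (B × C × D) :=
  {p | tailFits b c e f (cellType τB τC τD p)}

variable (τB τC τD) in
/-- The product of the last three sides of the block with corner `(!f, b, c, e)`. -/
abbrev TailSides (b c e f : Bool) : Type _ :=
  side τB b (xor b c) × side τC c (xor c e) × side τD e (xor e f)

/-- The cell with given coordinates in three sides. -/
def cell {R : Finset B} {S : Finset C} {T : Finset D} (x : R × S × T) : B × C × D :=
  (x.1, x.2.1, x.2.2)

variable (τA τB τC τD) [IsEndTyping τA] [IsEndTyping τB] [IsEndTyping τC] [IsEndTyping τD] in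
/-- The relations which the states of the outermost blocks and the stopper impose on the kernel of
an operator acting on the last three parties. -/
structure OuterLayerKernel (E : Matrix (B × C × D) (B × C × D) ℂ) : Prop where
  cross : ∀ {b c e f b' c' e' f' : Bool}, (b, c, e, f) ≠ (b', c', e', f') →
    ∃ v u : A × B × C × D → ℂ,
      ∀ a ∈ (side τA (!f) (f == b) : Set A), ∀ p ∈ tailBox τB τC τD b c e f,
      ∀ a' ∈ (side τA (!f') (f' == b') : Set A), ∀ q ∈ tailBox τB τC τD b' c' e' f',
        ((1 : Matrix A A ℂ) ⊗ₖ E) (a, p) (a', q) = v (a, p) + u (a', q)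
  same : ∀ b c e f : Bool,
    ∃ k v u : side τA (!f) (f == b) × TailSides τB τC τD b c e f → ℂ,
      ∀ p q, ((1 : Matrix A A ℂ) ⊗ₖ E) (p.1, cell p.2) (q.1, cell q.2) = k (p - q) + v p + u q
  colSum : ∀ {b c e f : Bool} {p q : B × C × D}, p ∈ tailBox τB τC τD b c e f →
    q ∈ tailBox τB τC τD b c e f → ∑ r, E r p = ∑ r, E r q

theorem exists_cell_eq {b c e f : Bool} {p : B × C × D} (hp : p ∈ tailBox τB τC τD b c e f) :
    ∃ x : TailSides τB τC τD b c e f, cell x = p := by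
  simp only [tailBox, tailFits, cellType, Set.mem_ofPred_eq, Bool.and_eq_true] at hp
  exact ⟨(⟨p.1, mem_side.2 hp.1.1⟩, ⟨p.2.1, mem_side.2 hp.1.2⟩, ⟨p.2.2, mem_side.2 hp.2⟩), rfl⟩

theorem mem_slice_iff {a : Bool} {x : TailSides τB τC τD a (!a) a (!a)} :
    cell x ∈ tailBox τB τC τD a (!a) a a ↔ τD x.2.2 = some a := by
  have hB := or_iff_not_imp_left.2 (eq_none_of_mem_side x.1)
  have hC := or_iff_not_imp_left.2 (eq_none_of_mem_side x.2.1)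
  simp [tailBox, tailFits, cellType, cell, fits, hB, hC]

omit [Fintype B] [Fintype C] [Fintype D] in
theorem exists_cellType_eq [IsEndTyping τB] [IsEndTyping τC] [IsEndTyping τD] (t : CellType) :
    ∃ p, cellType τB τC τD p = t := by
  obtain ⟨x, hx⟩ := IsEndTyping.surjective (τ := τB) t.1
  obtain ⟨y, hy⟩ := IsEndTyping.surjective (τ := τC) t.2.1
  obtain ⟨z, hz⟩ := IsEndTyping.surjective (τ := τD) t.2.2
  exact ⟨(x, y, z), by simp only [cellType, hx, hy, hz]⟩

theorem exists_tailFits_wide :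
    ∀ t : CellType, t ≠ (none, none, none) → ∃ b c e, tailFits b c e b t := by
  decide

/-- The number of coordinates of a cell which are ends. -/
def numEnds (t : CellType) : ℕ :=
  t.1.isSome.toNat + t.2.1.isSome.toNat + t.2.2.isSome.toNat

theorem exists_tailFits_numEnds_lt :
    ∀ t : CellType, t ≠ (none, none, none) → ∃ b c e f t',
      tailFits b c e f t ∧ tailFits b c e f t' ∧ numEnds t' < numEnds t := by
  decide

theorem not_tailFits_wide_inner : ∀ b c e, ¬ tailFits b c e b (none, none, none) := by
  decide

theorem eq_of_tailFits_corner :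
    ∀ a t, tailFits a a a a t → t = (some a, some a, some a) := by
  decide

theorem tailFits_inner_of_slice :
    ∀ a t, tailFits a (!a) a a t → tailFits a (!a) a (!a) t := by
  decide

theorem tailFits_cases : ∀ a c t, tailFits a c (!a) a t →
    tailFits a c (!a) (!a) t ∨ tailFits a (!a) a (!a) t ∨ tailFits a a a (!a) t := by
  decide

theorem exists_tailFits_inner :
    ∀ a c, ∃ t, tailFits a c (!a) a t ∧ tailFits a (!a) a (!a) t := by
  decide

namespace OuterLayerKernel

variable [IsEndTyping τA] [IsEndTyping τB] [IsEndTyping τC] [IsEndTyping τD]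
  {E : Matrix (B × C × D) (B × C × D) ℂ} (hE : OuterLayerKernel τA τB τC τD E)
include hE

theorem wide_wide_eq_zero {b c e b' c' e' : Bool} (hne : (b, c, e) ≠ (b', c', e'))
    {p q : B × C × D} (hp : p ∈ tailBox τB τC τD b c e b) (hq : q ∈ tailBox τB τC τD b' c' e' b') :
    E p q = 0 := by
  obtain ⟨v, u, h⟩ := hE.cross (f := b) (f' := b')
    (show (b, c, e, b) ≠ (b', c', e', b') by simp_all)
  have surj := IsEndTyping.surjective (τ := τA)
  obtain ⟨m, hm⟩ := surj none
  obtain ⟨x, hx⟩ := surj (some !b)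
  obtain ⟨y, hy⟩ := surj (some !b')
  exact eq_zero_of_one_kronecker_eq_add h (a₀ := m) (a₁ := x) (a₂ := y) (by simp [hm, fits])
    (by simp [hm, fits]) (by simp [hx, fits]) (by simp [hy, fits])
    (by rintro rfl; simp_all) (by rintro rfl; simp_all) hp hq

theorem narrow_wide_const {b c e c' e' : Bool} {p p' q : B × C × D}
    (hp : p ∈ tailBox τB τC τD (!b) c' e' b) (hp' : p' ∈ tailBox τB τC τD (!b) c' e' b)
    (hq : q ∈ tailBox τB τC τD b c e b) : E p q = E p' q ∧ E q p = E q p' := by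
  have surj := IsEndTyping.surjective (τ := τA)
  obtain ⟨m, hm⟩ := surj none
  obtain ⟨x, hx⟩ := surj (some !b)
  have hmx : m ≠ x := by rintro rfl; simp_all
  obtain ⟨v, u, h⟩ := hE.cross (f := b) (f' := b)
    (show (!b, c', e', b) ≠ (b, c, e, b) by simp)
  obtain ⟨v', u', h'⟩ := hE.cross (f := b) (f' := b)
    (show (b, c, e, b) ≠ (!b, c', e', b) by simp)
  exact ⟨left_eq_of_one_kronecker_eq_add h (by simp [hx, fits]) (by simp [hx, fits])
      (by simp [hm, fits]) hmx hp hp' hq,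
    right_eq_of_one_kronecker_eq_add h' (by simp [hx, fits]) (by simp [hx, fits])
      (by simp [hm, fits]) hmx hq hp hp'⟩

theorem narrow_narrow_sub_eq_sub {a c e c' e' : Bool} (hne : (c, e) ≠ (c', e'))
    {p p' q q' : B × C × D} (hp : p ∈ tailBox τB τC τD a c e (!a))
    (hp' : p' ∈ tailBox τB τC τD a c e (!a)) (hq : q ∈ tailBox τB τC τD a c' e' (!a))
    (hq' : q' ∈ tailBox τB τC τD a c' e' (!a)) : E p q - E p' q = E p q' - E p' q' := by
  obtain ⟨v, u, h⟩ := hE.cross (f := !a) (f' := !a)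
    (show (a, c, e, !a) ≠ (a, c', e', !a) by simp_all)
  obtain ⟨x, hx⟩ := IsEndTyping.surjective (τ := τA) (some a)
  exact sub_eq_sub_of_one_kronecker_eq_add h (a := x) (by simp [hx, fits]) (by simp [hx, fits])
    hp hp' hq hq'

theorem eq_zero_of_mem_wide_of_notMem {b c e : Bool} {p q : B × C × D}
    (hq : q ∈ tailBox τB τC τD b c e b) (hp : p ∉ tailBox τB τC τD b c e b) :
    E p q = 0 ∧ E q p = 0 := by
  by_cases hinner : cellType τB τC τD p = (none, none, none)
  · obtain ⟨x, hx⟩ := IsEndTyping.surjective (τ := τB) (some !b)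
    obtain ⟨-, hC, hD⟩ : _ ∧ τC p.2.1 = none ∧ τD p.2.2 = none := by
      simpa only [cellType, Prod.mk.injEq] using hinner
    have hp' : (x, p.2) ∈ tailBox τB τC τD (!b) (!b) b (!b) := by
      simp [tailBox, cellType, tailFits, fits, hx, hC, hD]
    obtain ⟨h₁, h₂⟩ := hE.narrow_wide_const (c' := b) (e' := !b) (p := p) (p' := (x, p.2))
      (by simp [tailBox, hinner, tailFits, fits])
      (by simp [tailBox, cellType, tailFits, fits, hx, hC, hD]) hq
    exact ⟨h₁.trans (hE.wide_wide_eq_zero (by simp) hp' hq),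
      h₂.trans (hE.wide_wide_eq_zero (by simp) hq hp')⟩
  · obtain ⟨b', c', e', hp'⟩ := exists_tailFits_wide _ hinner
    have hne : (b', c', e') ≠ (b, c, e) := by
      rintro ⟨rfl, rfl, rfl⟩
      exact hp hp'
    exact ⟨hE.wide_wide_eq_zero hne hp' hq, hE.wide_wide_eq_zero hne.symm hq hp'⟩

theorem exists_eq_convolution_add (b c e f : Bool) :
    ∃ k v u : TailSides τB τC τD b c e f → ℂ,
      ∀ x y, E (cell x) (cell y) = k (x - y) + v x + u y := by
  obtain ⟨k, v, u, h⟩ := hE.same b c e f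
  refine ⟨fun x => k (0, x), fun x => v (0, x), fun x => u (0, x), fun x y => ?_⟩
  simpa using h (0, x) (0, y)

theorem wide_translate {b c e : Bool}
    (x y z : TailSides τB τC τD b c e b) :
    E (cell (x + z)) (cell (y + z)) = E (cell x) (cell y) := by
  obtain ⟨k, v, u, h⟩ := hE.same b c e b
  have surj := IsEndTyping.surjective (τ := τA)
  obtain ⟨m, hm⟩ := surj none
  obtain ⟨m', hm'⟩ := surj (some !b)
  have : Nontrivial (side τA (!b) (b == b)) :=
    ⟨⟨m, by simp [hm, fits]⟩, ⟨m', by simp [hm', fits]⟩, fun h => by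
      cases hm.symm.trans ((congrArg (fun x => τA x.1) h).trans hm')⟩
  refine translate_eq_of_one_kronecker_eq_convolution_add (E := E.submatrix cell cell)
    (k := k) (v := v) (u := u) (fun p q => ?_) x y z
  rw [← h]
  simp only [kroneckerMap_apply, one_apply, Subtype.ext_iff, submatrix_apply]

theorem exists_inner_eq_zero {a : Bool}
    {x y : TailSides τB τC τD a (!a) a (!a)} (hxy : x ≠ y) (hx : τD x.2.2 ≠ some a) :
    ∃ x' y' : TailSides τB τC τD a (!a) a (!a),
      x'.2.2 = x.2.2 ∧ y'.2.2 = y.2.2 ∧ (x.2.2 = y.2.2 → x' - y' = x - y) ∧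
        E (cell x') (cell y') = 0 := by
  obtain ⟨eB, heB⟩ := exists_mem_side τB (t := some a) (c := a) (ext := xor a !a) (by simp [fits])
  obtain ⟨mB, hmB⟩ := exists_mem_side τB (t := none) (c := a) (ext := xor a !a) (by simp [fits])
  obtain ⟨eC, heC⟩ := exists_mem_side τC (t := some !a) (c := !a) (ext := xor (!a) a)
    (by simp [fits])
  obtain ⟨mC, hmC⟩ := exists_mem_side τC (t := none) (c := !a) (ext := xor (!a) a)
    (by simp [fits])
  have hxD := eq_none_of_mem_side _ hx
  by_cases hB : x.1 = y.1
  · by_cases hC : x.2.1 = y.2.1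
    · have hD : x.2.2 ≠ y.2.2 := fun hD => hxy (Prod.ext hB (Prod.ext hC hD))
      refine ⟨(eB, mC, x.2.2), (mB, mC, y.2.2), rfl, rfl, fun h => absurd h hD,
        (hE.eq_zero_of_mem_wide_of_notMem (b := a) (c := a) (e := !a) ?_ ?_).2⟩
      · simp [tailBox, cellType, cell, tailFits, fits, heB, hmC, hxD]
      · simp [tailBox, cellType, cell, tailFits, fits, hmB]
    · have hne : τC (eC - (x.2.1 - y.2.1) : side τC (!a) (xor (!a) a)) ≠ some !a := by
        rwa [Ne, ← eq_iff_of_mem_side heC, sub_eq_self, sub_eq_zero]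
      refine ⟨(mB, eC, x.2.2), (mB, eC, x.2.2) - (x - y), rfl, sub_sub_cancel _ _,
        fun _ => sub_sub_cancel _ _,
        (hE.eq_zero_of_mem_wide_of_notMem (b := a) (c := !a) (e := !a) ?_ ?_).2⟩
      · simp [tailBox, cellType, cell, tailFits, fits, hmB, heC, hxD]
      · simp [tailBox, cellType, cell, tailFits, fits, hne]
  · have hne : τB (eB - (x.1 - y.1) : side τB a (xor a !a)) ≠ some a := by
      rwa [Ne, ← eq_iff_of_mem_side heB, sub_eq_self, sub_eq_zero]
    refine ⟨(eB, mC, x.2.2), (eB, mC, x.2.2) - (x - y), rfl, sub_sub_cancel _ _,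
      fun _ => sub_sub_cancel _ _,
      (hE.eq_zero_of_mem_wide_of_notMem (b := a) (c := a) (e := !a) ?_ ?_).2⟩
    · simp [tailBox, cellType, cell, tailFits, fits, heB, hmC, hxD]
    · simp [tailBox, cellType, cell, tailFits, fits, hne]

theorem inner_eq_zero_and_slice_const {m : B × C × D}
    (hm : cellType τB τC τD m = (none, none, none)) (hm₀ : E m m = 0) (a : Bool) :
    (∀ x y : TailSides τB τC τD a (!a) a (!a), τD x.2.2 ≠ some a → τD y.2.2 ≠ some a →
      E (cell x) (cell y) = 0) ∧
    ∃ r, ∀ x y : TailSides τB τC τD a (!a) a (!a), τD x.2.2 = some a → τD y.2.2 = some a →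
      E (cell x) (cell y) = r := by
  obtain ⟨k, v, u, hconv⟩ := hE.exists_eq_convolution_add a (!a) a (!a)
  obtain ⟨eB, heB⟩ := exists_mem_side τB (t := some a) (c := a) (ext := xor a !a) (by simp [fits])
  obtain ⟨eD, heD⟩ := exists_mem_side τD (t := some a) (c := a) (ext := xor a !a) (by simp [fits])
  obtain ⟨hmB, hmC, hmD⟩ : τB m.1 = none ∧ τC m.2.1 = none ∧ τD m.2.2 = none := by
    simpa only [cellType, Prod.mk.injEq] using hm
  let π : TailSides τB τC τD a (!a) a (!a) →+ side τD a (xor a !a) :=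
    (AddMonoidHom.snd _ _).comp (AddMonoidHom.snd _ _)
  have hπ {x} : π x = eD ↔ τD x.2.2 = some a := eq_iff_of_mem_side heD
  let m' : TailSides τB τC τD a (!a) a (!a) :=
    (⟨m.1, by simp [hmB, fits]⟩, ⟨m.2.1, by simp [hmC, fits]⟩, ⟨m.2.2, by simp [hmD, fits]⟩)
  have hne : eB - m'.1 ≠ 0 := fun h => by
    rw [sub_eq_zero] at h
    cases hmB.symm.trans ((congrArg (fun x => τB x.1) h).symm.trans heB)
  obtain ⟨h₁, r, h₂⟩ := eq_zero_or_mem_slice_of_convolution_add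
    (F := E.submatrix cell cell) (c₀ := eD) hconv π
    (fun x y hx hy => (hE.eq_zero_of_mem_wide_of_notMem (mem_slice_iff.2 (hπ.1 hx))
      (mt mem_slice_iff.1 (mt hπ.2 hy))).2)
    (fun x y hx hy => (hE.eq_zero_of_mem_wide_of_notMem (mem_slice_iff.2 (hπ.1 hy))
      (mt mem_slice_iff.1 (mt hπ.2 hx))).1)
    ⟨(m'.1, m'.2.1, eD), rfl⟩ ⟨m', mt hπ.1 (by simp [m', hmD]), hm₀⟩
    ⟨(eB - m'.1, 0, 0), fun h => hne (congrArg Prod.fst h), rfl⟩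
    (fun x y hxy hx _ => hE.exists_inner_eq_zero hxy (mt hπ.2 hx))
  exact ⟨fun x y hx hy => h₁ x y (mt hπ.1 hx) (mt hπ.1 hy),
    r, fun x y hx hy => h₂ x y (hπ.2 hx) (hπ.2 hy)⟩

variable {m : B × C × D} (hm : cellType τB τC τD m = (none, none, none)) (hm₀ : E m m = 0)
include hm hm₀

theorem column_eq_zero_of_inner {p : B × C × D} (hp : cellType τB τC τD p = (none, none, none))
    (q : B × C × D) : E q p = 0 := by
  by_cases hq : cellType τB τC τD q = (none, none, none)
  · have inner {r} (hr : cellType τB τC τD r = (none, none, none)) :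
        ∃ x : TailSides τB τC τD true false true false, cell x = r ∧ τD x.2.2 ≠ some true := by
      obtain ⟨x, rfl⟩ := exists_cell_eq (p := r)
        (show r ∈ tailBox τB τC τD true false true false by simp [tailBox, hr, tailFits, fits])
      exact ⟨x, rfl, by simp_all [cellType, cell]⟩
    obtain ⟨x, rfl, hx⟩ := inner hq
    obtain ⟨y, rfl, hy⟩ := inner hp
    exact (hE.inner_eq_zero_and_slice_const hm hm₀ true).1 x y hx hy
  · obtain ⟨b, c, e, hq'⟩ := exists_tailFits_wide _ hq
    refine (hE.eq_zero_of_mem_wide_of_notMem hq' ?_).2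
    simpa only [tailBox, Set.mem_ofPred_eq, hp] using not_tailFits_wide_inner b c e

theorem colSum_eq_zero (p : B × C × D) : ∑ r, E r p = 0 := by
  induction hn : numEnds (cellType τB τC τD p) using Nat.strong_induction_on generalizing p with
  | _ n ih =>
    by_cases hp : cellType τB τC τD p = (none, none, none)
    · exact Finset.sum_eq_zero fun r _ => hE.column_eq_zero_of_inner hm hm₀ hp r
    · obtain ⟨b, c, e, f, t, hpt, ht, hlt⟩ := exists_tailFits_numEnds_lt _ hp
      obtain ⟨q, rfl⟩ := exists_cellType_eq (τB := τB) (τC := τC) (τD := τD) t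
      rw [hE.colSum hpt ht, ih _ (hn ▸ hlt) q rfl]

theorem slice_eq_zero {a : Bool} {q : B × C × D} (hq : q ∈ tailBox τB τC τD a (!a) a a)
    (p : B × C × D) : E p q = 0 := by
  obtain ⟨r, hr⟩ := (hE.inner_eq_zero_and_slice_const hm hm₀ a).2
  have lift {p} (hp : p ∈ tailBox τB τC τD a (!a) a a) :
      ∃ x : TailSides τB τC τD a (!a) a (!a), cell x = p ∧ τD x.2.2 = some a := by
    obtain ⟨x, rfl⟩ := exists_cell_eq (p := p)
      (show p ∈ tailBox τB τC τD a (!a) a (!a) from tailFits_inner_of_slice a _ hp)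
    exact ⟨x, rfl, mem_slice_iff.1 hp⟩
  refine eq_zero_of_const_on_support (f := (E · q)) (fun p hp p' hp' => ?_)
    (fun _ hp => (hE.eq_zero_of_mem_wide_of_notMem hq hp).1) (hE.colSum_eq_zero hm hm₀ q) p
  obtain ⟨x, rfl, hx⟩ := lift hp
  obtain ⟨x', rfl, hx'⟩ := lift hp'
  obtain ⟨y, rfl, hy⟩ := lift hq
  exact (hr x y hx hy).trans (hr x' y hx' hy).symm

theorem inner_box_eq_zero {a : Bool} {p q : B × C × D} (hp : p ∈ tailBox τB τC τD a (!a) a (!a))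
    (hq : q ∈ tailBox τB τC τD a (!a) a (!a)) : E p q = 0 := by
  by_cases hp' : p ∈ tailBox τB τC τD a (!a) a a <;>
    by_cases hq' : q ∈ tailBox τB τC τD a (!a) a a
  · exact hE.slice_eq_zero hm hm₀ hq' p
  · exact (hE.eq_zero_of_mem_wide_of_notMem hp' hq').2
  · exact hE.slice_eq_zero hm hm₀ hq' p
  · obtain ⟨x, rfl⟩ := exists_cell_eq hp
    obtain ⟨y, rfl⟩ := exists_cell_eq hq
    rw [mem_slice_iff] at hp' hq'
    exact (hE.inner_eq_zero_and_slice_const hm hm₀ a).1 x y hp' hq'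

theorem column_eq_zero_of_mem_inner_box {a c : Bool} {p : B × C × D}
    (hp : p ∈ tailBox τB τC τD a c (!a) a) (hpI : p ∈ tailBox τB τC τD a (!a) a (!a))
    (q : B × C × D) : E q p = 0 := by
  have hmI : m ∈ tailBox τB τC τD a (!a) a (!a) := by simp [tailBox, hm, tailFits, fits]
  have const {c e} (hne : (c, e) ≠ (!a, a)) {q q'} (hq : q ∈ tailBox τB τC τD a c e (!a))
      (hq' : q' ∈ tailBox τB τC τD a c e (!a)) : E q p = E q' p := by
    have := hE.narrow_narrow_sub_eq_sub hne hq hq' hpI hmI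
    rwa [hE.column_eq_zero_of_inner hm hm₀ hm, hE.column_eq_zero_of_inner hm hm₀ hm, sub_self,
      sub_eq_zero] at this
  refine eq_zero_of_const_on_support (f := (E · p)) (S := tailBox τB τC τD a c (!a) (!a))
    (fun q hq q' hq' => const (by simp) hq hq') (fun q hq => ?_) (hE.colSum_eq_zero hm hm₀ p) q
  by_cases hqQ : q ∈ tailBox τB τC τD a c (!a) a
  · obtain hq' | hq' | hq' := tailFits_cases a c _ hqQ
    · exact absurd hq' hq
    · exact hE.inner_box_eq_zero hm hm₀ hq' hpI
    · obtain ⟨q', hq''⟩ := exists_cellType_eq (τB := τB) (τC := τC) (τD := τD)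
        (some a, some a, some a)
      rw [const (q' := q') (by simp) hq' (by simp [tailBox, hq'', tailFits, fits])]
      exact hE.wide_wide_eq_zero (b := a) (c := a) (e := a) (by simp)
        (by simp [tailBox, hq'', tailFits, fits]) hp
  · exact (hE.eq_zero_of_mem_wide_of_notMem hp hqQ).1

theorem wide_eq_zero {a c : Bool} {p q : B × C × D} (hp : p ∈ tailBox τB τC τD a c (!a) a)
    (hq : q ∈ tailBox τB τC τD a c (!a) a) : E p q = 0 := by
  obtain ⟨t, ht, htI⟩ := exists_tailFits_inner a c
  obtain ⟨r, rfl⟩ := exists_cellType_eq (τB := τB) (τC := τC) (τD := τD) t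
  obtain ⟨x, rfl⟩ := exists_cell_eq hp
  obtain ⟨y, rfl⟩ := exists_cell_eq hq
  obtain ⟨z, hz⟩ := exists_cell_eq (p := r) ht
  rw [← hE.wide_translate x y (z - y), add_sub_cancel, hz]
  exact hE.column_eq_zero_of_mem_inner_box hm hm₀ ht htI _

theorem corner_eq_zero {a : Bool} {q : B × C × D} (hq : q ∈ tailBox τB τC τD a a a a)
    (p : B × C × D) : E p q = 0 := by
  refine eq_zero_of_const_on_support (f := (E · q)) (fun p hp p' hp' => ?_)
    (fun _ hp => (hE.eq_zero_of_mem_wide_of_notMem hq hp).1) (hE.colSum_eq_zero hm hm₀ q) p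
  have h := eq_of_tailFits_corner a _ hp
  have h' := eq_of_tailFits_corner a _ hp'
  simp only [cellType, Prod.mk.injEq] at h h'
  rw [Prod.ext (IsEndTyping.eq_of_eq_some h.1 h'.1) (Prod.ext
    (IsEndTyping.eq_of_eq_some h.2.1 h'.2.1) (IsEndTyping.eq_of_eq_some h.2.2 h'.2.2))]

theorem eq_zero : E = 0 := by
  ext p q
  by_cases hq : cellType τB τC τD q = (none, none, none)
  · exact hE.column_eq_zero_of_inner hm hm₀ hq p
  · obtain ⟨a, c, e, hq'⟩ := exists_tailFits_wide _ hq
    by_cases hp : p ∈ tailBox τB τC τD a c e a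
    · obtain rfl | rfl := Bool.eq_or_eq_not e a
      · obtain rfl | rfl := Bool.eq_or_eq_not c e
        · exact hE.corner_eq_zero hm hm₀ hq' p
        · exact hE.slice_eq_zero hm hm₀ hq' p
      · exact hE.wide_eq_zero hm hm₀ hp hq'
    · exact (hE.eq_zero_of_mem_wide_of_notMem hq' hp).1

end OuterLayerKernel

end OuterLayer

section Extend

variable {X Y Z : Type*} [Fintype X] [Fintype Y] [Fintype Z] {f : Y → X} {g : Z → X}

theorem extend_dotProduct (hf : f.Injective) (u : Y → ℂ) (w : X → ℂ) :
    Function.extend f u 0 ⬝ᵥ w = u ⬝ᵥ w ∘ f :=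
  (Fintype.sum_of_injective f hf _ _
    (fun x hx => by rw [Function.extend_apply' _ _ _ hx, Pi.zero_apply, zero_mul])
    fun y => by rw [hf.extend_apply, Function.comp_apply]).symm

theorem star_extend_dotProduct (hf : f.Injective) (u : Y → ℂ) (w : X → ℂ) :
    star (Function.extend f u 0) ⬝ᵥ w = star u ⬝ᵥ w ∘ f := by
  have : star (Function.extend f u 0) = Function.extend f (star u) 0 := by
    ext x
    refine (Function.apply_extend star f 0 x).trans ?_
    simp only [Function.comp_def, Pi.zero_apply, star_zero]
    rfl
  rw [this, extend_dotProduct hf]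

theorem mulVec_extend (hg : g.Injective) (K : Matrix X X ℂ) (w : Z → ℂ) :
    K *ᵥ Function.extend g w 0 = K.submatrix id g *ᵥ w := by
  ext x
  rw [mulVec, dotProduct_comm, extend_dotProduct hg, dotProduct_comm]
  rfl

theorem star_extend_dotProduct_mulVec_extend (hf : f.Injective) (hg : g.Injective)
    (K : Matrix X X ℂ) (u : Y → ℂ) (w : Z → ℂ) :
    star (Function.extend f u 0) ⬝ᵥ K *ᵥ Function.extend g w 0 =
      star u ⬝ᵥ K.submatrix f g *ᵥ w := by
  rw [mulVec_extend hg, star_extend_dotProduct hf]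
  rfl

end Extend

section BoxPartition

variable {ι κ : Type*} {X : ι → Type*}

/-- The points of a product of finite sets. -/
abbrev Box (S : ∀ j, Finset (X j)) : Type _ := ∀ j, S j

/-- The point of the whole product set underlying a point of a box. -/
def boxVal {S : ∀ j, Finset (X j)} (x : Box S) (j : ι) : X j := x j

theorem boxVal_injective (S : ∀ j, Finset (X j)) : Function.Injective (boxVal (S := S)) :=
  fun _ _ h => funext fun j => Subtype.ext (congrFun h j)

theorem mem_range_boxVal {S : ∀ j, Finset (X j)} {x : ∀ j, X j} :
    x ∈ Set.range (boxVal (S := S)) ↔ ∀ j, x j ∈ S j :=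
  ⟨by rintro ⟨y, rfl⟩ j; exact (y j).2, fun h => ⟨fun j => ⟨x j, h j⟩, rfl⟩⟩

/-- The boxes `S β` partition the product set. -/
def IsBoxPartition (S : κ → ∀ j, Finset (X j)) : Prop :=
  ∀ x : ∀ j, X j, ∃! β, ∀ j, x j ∈ S β j

theorem sum_card_box [Fintype ι] [DecidableEq ι] [Fintype κ] [∀ j, Fintype (X j)]
    {S : κ → ∀ j, Finset (X j)} (hS : IsBoxPartition S) :
    ∑ β, Fintype.card (Box (S β)) = ∏ j, Fintype.card (X j) := by
  rw [← Fintype.card_sigma, ← Fintype.card_pi]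
  refine Fintype.card_of_bijective (f := fun x : Σ β, Box (S β) => boxVal x.2) ⟨?_, fun x => ?_⟩
  · rintro ⟨β, x⟩ ⟨β', x'⟩ (h : boxVal x = boxVal x')
    obtain rfl : β = β' := (hS (boxVal x)).unique (fun j => (x j).2) fun j => by
      rw [h]
      exact (x' j).2
    rw [boxVal_injective _ h]
  · obtain ⟨β, hβ, -⟩ := hS x
    exact ⟨⟨β, fun j => ⟨x j, hβ j⟩⟩, rfl⟩

/-- The labels of the states of a partition into boxes: `none` is the stopper, and every box
contributes its nontrivial characters. -/
abbrev StateLabel (S : κ → ∀ j, Finset (X j)) [∀ β j, Nonempty (S β j)] : Type _ :=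
  Option (Σ β, {χ : AddChar (Box (S β)) ℂ // χ ≠ 0})

/-- The states of a partition into boxes: the all-ones stopper, and the nontrivial characters of
the boxes, extended by zero. -/
noncomputable def boxState (S : κ → ∀ j, Finset (X j)) [∀ β j, Nonempty (S β j)] :
    StateLabel S → (∀ j, X j) → ℂ
  | none => 1
  | some ⟨_, χ⟩ => Function.extend boxVal χ.1 0

variable {S : κ → ∀ j, Finset (X j)} [∀ β j, Nonempty (S β j)]

theorem boxState_ne_zero [∀ j, Nonempty (X j)] (l : StateLabel S) : boxState S l ≠ 0 := by
  rcases l with _ | ⟨β, χ, _⟩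
  · exact one_ne_zero
  · intro h
    have := congrFun h (boxVal (0 : Box (S β)))
    rw [boxState, (boxVal_injective _).extend_apply, AddChar.map_zero_eq_one] at this
    exact one_ne_zero this

variable [Fintype ι]

theorem exists_boxState_eq_prod (l : StateLabel S) :
    ∃ v : ∀ j, X j → ℂ, ∀ x, boxState S l x = ∏ j, v j (x j) := by
  classical
  rcases l with _ | ⟨β, χ, _⟩
  · exact ⟨fun _ _ => 1, fun x => by simp [boxState]⟩
  refine ⟨fun j y => if h : y ∈ S β j then χ (Pi.single j ⟨y, h⟩) else 0, fun x => ?_⟩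
  by_cases hx : ∀ j, x j ∈ S β j
  · obtain ⟨y, rfl⟩ := mem_range_boxVal.2 hx
    have hprod := map_prod χ.toMonoidHom (fun j => Multiplicative.ofAdd (Pi.single j (y j))) univ
    rw [← ofAdd_sum, Finset.univ_sum_single] at hprod
    refine ((boxVal_injective _).extend_apply _ _ _).trans (hprod.trans ?_)
    refine Finset.prod_congr rfl fun j _ => ?_
    simp only [boxVal, Subtype.coe_eta, coe_mem, dite_true]
    rfl
  · obtain ⟨j, hj⟩ := not_forall.1 hx
    rw [Finset.prod_eq_zero (mem_univ j) (dif_neg hj)]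
    exact Function.extend_apply' _ _ _ (mt mem_range_boxVal.1 hx)

variable [∀ j, Fintype (X j)] [DecidableEq ι]

theorem star_boxState_dotProduct (hS : IsBoxPartition S) {l l' : StateLabel S} (h : l ≠ l') :
    star (boxState S l) ⬝ᵥ boxState S l' = 0 := by
  rcases l with _ | ⟨β, χ, hχ⟩ <;> rcases l' with _ | ⟨β', ξ, hξ⟩
  · exact absurd rfl h
  · rw [boxState, boxState, star_one, dotProduct_comm, extend_dotProduct (boxVal_injective _)]
    simpa [dotProduct] using AddChar.sum_eq_zero_iff_ne_zero.2 hξ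
  · rw [boxState, boxState, star_extend_dotProduct (boxVal_injective _), star_char]
    simpa [dotProduct] using AddChar.sum_eq_zero_iff_ne_zero.2 (inv_ne_one.2 hχ)
  · rw [boxState, boxState, star_extend_dotProduct (boxVal_injective _)]
    obtain rfl | hβ := eq_or_ne β β'
    · have hne : χ⁻¹ * ξ ≠ 0 := by
        rintro h'
        obtain rfl : χ = ξ := inv_mul_eq_one.1 h'
        exact h rfl
      rw [Function.extend_comp (boxVal_injective _), star_char, dotProduct]
      simpa only [AddChar.mul_apply] using AddChar.sum_eq_zero_iff_ne_zero.2 hne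
    · rw [dotProduct]
      refine Finset.sum_eq_zero fun x _ => ?_
      rw [Function.comp_apply, Function.extend_apply', Pi.zero_apply, mul_zero]
      intro hx
      exact hβ ((hS (boxVal x)).unique (fun j => (x j).2) (mem_range_boxVal.1 hx))

theorem boxState_injective [∀ j, Nonempty (X j)] (hS : IsBoxPartition S) :
    Function.Injective (boxState S) := by
  intro l l' h
  by_contra hne
  have := star_boxState_dotProduct hS hne
  rw [h, dotProduct_star_self_eq_zero] at this
  exact boxState_ne_zero l' this

theorem card_stateLabel_add_card [Fintype κ] (hS : IsBoxPartition S) :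
    Nat.card (StateLabel S) + Fintype.card κ = 1 + ∏ j, Fintype.card (X j) := by
  classical
  have hbox (β : κ) : Fintype.card {χ : AddChar (Box (S β)) ℂ // χ ≠ 0} + 1 =
      Fintype.card (Box (S β)) := by
    rw [← Fintype.card_option, Fintype.card_congr (Equiv.optionSubtypeNe 0),
      ← AddChar.card_eq (α := Box (S β))]
  rw [Nat.card_eq_fintype_card, Fintype.card_option, Fintype.card_sigma, ← sum_card_box hS,
    ← Finset.sum_congr rfl fun β _ => hbox β, Finset.sum_add_distrib, Finset.sum_const,
    Finset.card_univ, smul_eq_mul, mul_one]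
  ring

theorem const_of_forall_star_boxState_dotProduct {φ : (∀ j, X j) → ℂ}
    (hφ : ∀ l : StateLabel S, star (boxState S l) ⬝ᵥ φ = 0) {β : κ} {x y : ∀ j, X j}
    (hx : ∀ j, x j ∈ S β j) (hy : ∀ j, y j ∈ S β j) : φ x = φ y := by
  obtain ⟨x, rfl⟩ := mem_range_boxVal.2 hx
  obtain ⟨y, rfl⟩ := mem_range_boxVal.2 hy
  refine eq_of_forall_star_char_dotProduct_eq_zero (g := φ ∘ boxVal) (fun χ hχ => ?_) x y
  rw [← star_extend_dotProduct (boxVal_injective _)]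
  exact hφ (some ⟨β, χ, hχ⟩)

/-- The operator with matrix `K` keeps the states of a box partition orthogonal. -/
def KeepsOrthogonal (S : κ → ∀ j, Finset (X j)) [∀ β j, Nonempty (S β j)]
    (K : Matrix (∀ j, X j) (∀ j, X j) ℂ) : Prop :=
  ∀ l l' : StateLabel S, l ≠ l' → star (boxState S l) ⬝ᵥ K *ᵥ boxState S l' = 0

namespace KeepsOrthogonal

variable {K : Matrix (∀ j, X j) (∀ j, X j) ℂ}

theorem sub_smul_one [∀ j, DecidableEq (X j)] (hK : KeepsOrthogonal S K) (hS : IsBoxPartition S)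
    (t : ℂ) : KeepsOrthogonal S (K - t • 1) := fun l l' h => by
  rw [sub_mulVec, smul_mulVec, one_mulVec, dotProduct_sub, dotProduct_smul, hK l l' h,
    star_boxState_dotProduct hS h, smul_zero, sub_zero]

theorem exists_eq_add (hK : KeepsOrthogonal S K) {β β' : κ} (hβ : β ≠ β') :
    ∃ v u : (∀ j, X j) → ℂ, ∀ x y, (∀ j, x j ∈ S β j) → (∀ j, y j ∈ S β' j) →
      K x y = v x + u y := by
  obtain ⟨v, u, h⟩ := exists_eq_add_of_forall_char (F := K.submatrix boxVal boxVal)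
    fun (χ : AddChar (Box (S β)) ℂ) (ξ : AddChar (Box (S β')) ℂ) hχ hξ => by
      rw [← star_extend_dotProduct_mulVec_extend (boxVal_injective _) (boxVal_injective _)]
      exact hK (some ⟨β, χ, hχ⟩) (some ⟨β', ξ, hξ⟩) (by simp [hβ])
  refine ⟨Function.extend boxVal v 0, Function.extend boxVal u 0, fun x y hx hy => ?_⟩
  obtain ⟨x, rfl⟩ := mem_range_boxVal.2 hx
  obtain ⟨y, rfl⟩ := mem_range_boxVal.2 hy
  simpa only [(boxVal_injective _).extend_apply, submatrix_apply] using h x y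

theorem exists_eq_convolution_add (hK : KeepsOrthogonal S K) (β : κ) :
    ∃ k v u : Box (S β) → ℂ, ∀ x y, K (boxVal x) (boxVal y) = k (x - y) + v x + u y :=
  exists_eq_convolution_add_of_forall_char (F := K.submatrix boxVal boxVal) fun χ ξ hχ hξ hne => by
    rw [← star_extend_dotProduct_mulVec_extend (boxVal_injective _) (boxVal_injective _)]
    exact hK (some ⟨β, χ, hχ⟩) (some ⟨β, ξ, hξ⟩) (by simp [hne])

theorem sum_eq_sum (hK : KeepsOrthogonal S K) {β : κ} {x y : ∀ j, X j}
    (hx : ∀ j, x j ∈ S β j) (hy : ∀ j, y j ∈ S β j) : ∑ z, K z x = ∑ z, K z y := by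
  obtain ⟨x, rfl⟩ := mem_range_boxVal.2 hx
  obtain ⟨y, rfl⟩ := mem_range_boxVal.2 hy
  refine eq_of_forall_char_dotProduct_eq_zero (g := fun x => ∑ z, K z (boxVal x))
    (fun χ hχ => ?_) x y
  have := hK none (some ⟨β, χ, hχ⟩) (by simp)
  rw [boxState, boxState, star_one, dotProduct_mulVec, dotProduct_comm,
    extend_dotProduct (boxVal_injective _), dotProduct_comm] at this
  simpa [vecMul, dotProduct, Function.comp_def] using this

end KeepsOrthogonal

end BoxPartition

section LayerBlocks

/-- The distance of a point of a line to the nearer of the two ends. -/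
def depth {n : ℕ} (x : Fin n) : ℕ := min x (n - 1 - x)

/-- The typing of the points of a line with respect to the ends of its `l`-th layer. -/
def endType {n : ℕ} (l : ℕ) (x : Fin n) : Option Bool :=
  if (x : ℕ) = l then some false else if (x : ℕ) + l + 1 = n then some true else none

theorem endType_eq_some {n l : ℕ} {x : Fin n} {b : Bool} (hn : 2 * l + 1 < n) :
    endType l x = some b ↔ (x : ℕ) = if b then n - 1 - l else l := by
  have := x.2
  unfold endType
  cases b <;> simp only [Bool.false_eq_true, if_true, if_false] <;> split_ifs <;> simp <;> omega

theorem endType_ne_none {n l : ℕ} {x : Fin n} (hx : l ≤ depth x) :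
    endType l x ≠ none ↔ depth x = l := by
  unfold endType
  unfold depth at hx ⊢
  split_ifs <;> simp <;> omega

theorem isEndTyping_endType {n l : ℕ} (hn : 2 * l + 3 ≤ n) :
    IsEndTyping (endType l : Fin n → Option Bool) where
  surjective t := by
    match t with
    | none =>
      refine ⟨⟨l + 1, by omega⟩, ?_⟩
      rw [endType, if_neg (by simp), if_neg (by simp; omega)]
    | some b =>
      refine ⟨⟨if b then n - 1 - l else l, by split_ifs <;> omega⟩, ?_⟩
      rw [endType_eq_some (by omega)]
  eq_of_eq_some hx hy := by
    rw [endType_eq_some (by omega)] at hx hy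
    exact Fin.ext (hx.trans hy.symm)

/-- Whether the block with corner `c` contains the points between the ends in direction `j`. This
is so when the next coordinate of the corner differs, where the cycle of the four parties is closed
up with a twist. -/
def isExtended (c : Fin 4 → Bool) (j : Fin 4) : Bool :=
  xor (xor (c j) (c (j + 1))) (j == 3)

/- An end determines its own coordinate of the corner, and a point between the ends forces its
coordinate to differ from the next one in the twisted cycle. -/
set_option maxRecDepth 10000 in
theorem existsUnique_corner : ∀ t : Fin 4 → Option Bool, (∃ j, t j ≠ none) →
    ∃! c : Fin 4 → Bool, ∀ j, fits (t j) (c j) (isExtended c j) := by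
  unfold ExistsUnique
  decide

theorem exists_isExtended_eq_false : ∀ c : Fin 4 → Bool, ∃ j, isExtended c j = false := by
  decide

/-- The labels of the blocks: `none` is the interior box, and `some (l, c)` is the block with
corner `c` of the `l`-th layer. -/
abbrev BlockLabel (s : ℕ) : Type := Option (Fin (s + 1) × (Fin 4 → Bool))

/-- The sides of the blocks which make up the layers `0, …, s` and the remaining interior box. -/
def block (d : Fin 4 → ℕ) (s : ℕ) : BlockLabel s → ∀ j, Finset (Fin (d j))
  | none, _ => univ.filter fun x => s < depth x
  | some (l, c), j => (side (endType l) (c j) (isExtended c j)).filter fun x => l ≤ depth x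

variable {d : Fin 4 → ℕ} {s : ℕ} {x : ∀ j, Fin (d j)}

theorem forall_mem_block_none : (∀ j, x j ∈ block d s none j) ↔ ∀ j, s < depth (x j) := by
  simp only [block, mem_filter, mem_univ, true_and]

theorem forall_mem_block_some {l : Fin (s + 1)} {c : Fin 4 → Bool} :
    (∀ j, x j ∈ block d s (some (l, c)) j) ↔
      (∀ j, fits (endType l (x j)) (c j) (isExtended c j)) ∧ ∀ j, l ≤ depth (x j) := by
  simp only [block, mem_filter, mem_side, forall_and]

theorem exists_depth_eq_of_fits {l : ℕ} {c : Fin 4 → Bool} (hle : ∀ j, l ≤ depth (x j))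
    (hfits : ∀ j, fits (endType l (x j)) (c j) (isExtended c j)) : ∃ j, depth (x j) = l := by
  obtain ⟨j, hj⟩ := exists_isExtended_eq_false c
  refine ⟨j, (endType_ne_none (hle j)).1 fun h => ?_⟩
  simpa [fits, h, hj] using hfits j

theorem existsUnique_block_some (l : Fin (s + 1)) (hle : ∀ j, l ≤ depth (x j))
    (hl : ∃ j, depth (x j) = l) : ∃! c, ∀ j, x j ∈ block d s (some (l, c)) j := by
  obtain ⟨j, hj⟩ := hl
  simpa only [forall_mem_block_some, hle, implies_true, and_true] using
    existsUnique_corner (fun j => endType l (x j)) ⟨j, (endType_ne_none (hle j)).2 hj⟩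

theorem isBoxPartition_block (d : Fin 4 → ℕ) (s : ℕ) : IsBoxPartition (block d s) := by
  intro x
  obtain ⟨j, hj⟩ := Finite.exists_min fun j => depth (x j)
  have layer {l : Fin (s + 1)} {c} (h : ∀ j, x j ∈ block d s (some (l, c)) j) :
      depth (x j) = l := by
    obtain ⟨hfits, hle⟩ := forall_mem_block_some.1 h
    obtain ⟨i, hi⟩ := exists_depth_eq_of_fits hle hfits
    exact le_antisymm ((hj i).trans hi.le) (hle j)
  obtain hs | hs := lt_or_ge s (depth (x j))
  · refine ⟨none, forall_mem_block_none.2 fun i => hs.trans_le (hj i), ?_⟩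
    rintro (_ | ⟨l, c⟩) h
    · rfl
    · exact absurd (layer h) (by omega)
  · have hlt := Nat.lt_succ_of_le hs
    obtain ⟨c, hc, hunique⟩ := existsUnique_block_some ⟨depth (x j), hlt⟩ hj ⟨j, rfl⟩
    refine ⟨some (⟨depth (x j), hlt⟩, c), hc, ?_⟩
    rintro (_ | ⟨l, c'⟩) h
    · exact absurd (forall_mem_block_none.1 h j) hs.not_gt
    · obtain rfl : l = ⟨depth (x j), hlt⟩ := Fin.ext (layer h).symm
      rw [hunique c' h]

theorem nonempty_block (hd : ∀ j, 2 * s + 3 ≤ d j) (β : BlockLabel s) (j : Fin 4) :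
    Nonempty (block d s β j) := by
  have hj := hd j
  rcases β with _ | ⟨l, c⟩
  · refine ⟨⟨⟨s + 1, by omega⟩, mem_filter.2 ⟨mem_univ _, ?_⟩⟩⟩
    simp only [depth]
    omega
  · have := isEndTyping_endType (n := d j) (l := l) (by omega)
    obtain ⟨x, hx⟩ := IsEndTyping.surjective (τ := (endType l : Fin (d j) → _)) (some (c j))
    have hval := (endType_eq_some (by omega)).1 hx
    refine ⟨x, mem_filter.2 ⟨by simp [hx, fits], ?_⟩⟩
    unfold depth
    split_ifs at hval <;> omega

theorem block_zero (c : Fin 4 → Bool) (j : Fin 4) :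
    block d s (some (0, c)) j = side (endType 0) (c j) (isExtended c j) := by
  simp [block]

end LayerBlocks

section Cyclic

theorem forall_iff_cyclic {p : Fin 4 → Prop} (i : Fin 4) :
    (∀ j, p j) ↔ p i ∧ p (i + 1) ∧ p (i + 2) ∧ p (i + 3) := by
  refine ⟨fun h => ⟨h _, h _, h _, h _⟩, fun ⟨h₀, h₁, h₂, h₃⟩ j => ?_⟩
  have hj : ∀ i j : Fin 4, j = i ∨ j = i + 1 ∨ j = i + 2 ∨ j = i + 3 := by decide
  obtain rfl | rfl | rfl | rfl := hj i j <;> assumption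

theorem cyclic_ne : ∀ i : Fin 4, i + 1 ≠ i ∧ i + 2 ≠ i ∧ i + 3 ≠ i := by
  decide

variable {X : Fin 4 → Type*} [∀ j, Fintype (X j)]

variable (X) in
/-- The coordinates of a tuple, read off in the cyclic order which starts with the party `i`. -/
noncomputable def cyclicEquiv (i : Fin 4) :
    (∀ j, X j) ≃ X i × X (i + 1) × X (i + 2) × X (i + 3) :=
  Equiv.ofBijective (fun x => (x i, x (i + 1), x (i + 2), x (i + 3))) <| by
    refine (Fintype.bijective_iff_injective_and_card _).2 ⟨fun x y h => ?_, ?_⟩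
    · simp only [Prod.mk.injEq] at h
      exact funext ((forall_iff_cyclic i).2 h)
    · rw [Fintype.card_pi, ← Equiv.prod_comp (Equiv.addLeft i), Fin.prod_univ_four]
      simp only [Fintype.card_prod, Equiv.coe_addLeft, add_zero, mul_assoc]
      rfl

theorem cyclicEquiv_apply (i : Fin 4) (x : ∀ j, X j) :
    cyclicEquiv X i x = (x i, x (i + 1), x (i + 2), x (i + 3)) := rfl

theorem cyclicEquiv_symm_apply (i : Fin 4) (p : X i × X (i + 1) × X (i + 2) × X (i + 3)) :
    (cyclicEquiv X i).symm p i = p.1 ∧ (cyclicEquiv X i).symm p (i + 1) = p.2.1 ∧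
      (cyclicEquiv X i).symm p (i + 2) = p.2.2.1 ∧ (cyclicEquiv X i).symm p (i + 3) = p.2.2.2 := by
  simpa only [cyclicEquiv_apply, Prod.ext_iff] using (cyclicEquiv X i).apply_symm_apply p

theorem cyclicEquiv_symm_sub [∀ j, AddCommGroup (X j)] (i : Fin 4)
    (p q : X i × X (i + 1) × X (i + 2) × X (i + 3)) :
    (cyclicEquiv X i).symm (p - q) = (cyclicEquiv X i).symm p - (cyclicEquiv X i).symm q := by
  rw [Equiv.symm_apply_eq, cyclicEquiv_apply]
  simp only [Pi.sub_apply, cyclicEquiv_symm_apply]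
  rfl

end Cyclic

section ActsTrivially

/-- The operator with matrix `K` acts as the identity on the party `i`. -/
structure ActsTriviallyOn {ι : Type*} [DecidableEq ι] {X : ι → Type*} (i : ι)
    (K : Matrix (∀ j, X j) (∀ j, X j) ℂ) : Prop where
  eq_zero : ∀ {x y}, x i ≠ y i → K x y = 0
  update : ∀ {x y} a, x i = y i → K (Function.update x i a) (Function.update y i a) = K x y

theorem ActsTriviallyOn.sub_smul_one {ι : Type*} [DecidableEq ι] {X : ι → Type*} {i : ι}
    {K : Matrix (∀ j, X j) (∀ j, X j) ℂ} [DecidableEq (∀ j, X j)] (hK : ActsTriviallyOn i K)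
    (t : ℂ) : ActsTriviallyOn i (K - t • 1) where
  eq_zero {x y} h := by
    have hne : x ≠ y := fun h' => h (congrFun h' i)
    simp [hK.eq_zero h, hne]
  update {x y} a h := by
    have heq : Function.update x i a = Function.update y i a ↔ x = y := by
      refine ⟨fun h' => funext fun j => ?_, fun h' => h' ▸ rfl⟩
      obtain rfl | hj := eq_or_ne j i
      · exact h
      · simpa [hj] using congrFun h' j
    simp [hK.update a h, one_apply, heq]

variable {X : Fin 4 → Type*} [∀ j, Fintype (X j)]

theorem update_cyclicEquiv_symm (i : Fin 4) (a a' : X i) (p : X (i + 1) × X (i + 2) × X (i + 3)) :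
    Function.update ((cyclicEquiv X i).symm (a, p)) i a' = (cyclicEquiv X i).symm (a', p) := by
  obtain ⟨h₁, h₂, h₃⟩ := cyclic_ne i
  rw [Equiv.eq_symm_apply, cyclicEquiv_apply]
  simp [h₁, h₂, h₃, cyclicEquiv_symm_apply]

theorem ActsTriviallyOn.exists_eq_one_kronecker {i : Fin 4} [DecidableEq (X i)] [Nonempty (X i)]
    {K : Matrix (∀ j, X j) (∀ j, X j) ℂ} (hK : ActsTriviallyOn i K) :
    ∃ E : Matrix (X (i + 1) × X (i + 2) × X (i + 3)) (X (i + 1) × X (i + 2) × X (i + 3)) ℂ,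
      K.submatrix (cyclicEquiv X i).symm (cyclicEquiv X i).symm =
        (1 : Matrix (X i) (X i) ℂ) ⊗ₖ E := by
  let a₀ := Classical.arbitrary (X i)
  refine ⟨.of fun p q => K ((cyclicEquiv X i).symm (a₀, p)) ((cyclicEquiv X i).symm (a₀, q)), ?_⟩
  ext ⟨a, p⟩ ⟨a', q⟩
  rw [submatrix_apply, kroneckerMap_apply, one_apply, of_apply]
  split_ifs with h
  · obtain rfl := h
    rw [one_mul, ← hK.update a₀ (by simp only [cyclicEquiv_symm_apply]), update_cyclicEquiv_symm,
      update_cyclicEquiv_symm]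
  · rw [zero_mul, hK.eq_zero (by simpa only [cyclicEquiv_symm_apply])]

end ActsTrivially

section Rotation

/-- The typing of the points of the `j`-th line with respect to its ends, flipped when the party `j`
comes before `i`: then the twist in the cyclic order occurs before the party `i`. -/
def twistedType {d : Fin 4 → ℕ} (i j : Fin 4) (x : Fin (d j)) : Option Bool :=
  (endType 0 x).map (xor (decide (j < i)))

/-- The corner whose coordinates in the cyclic order starting with `i` are `!f, b, c, e` up to the
flips of `twistedType`. -/
def twistedCorner (i : Fin 4) (b c e f : Bool) (j : Fin 4) : Bool :=
  xor (decide (j < i)) (![!f, b, c, e] (j - i))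

theorem isExtended_twistedCorner : ∀ i b c e f,
    isExtended (twistedCorner i b c e f) i = (f == b) ∧
      isExtended (twistedCorner i b c e f) (i + 1) = xor b c ∧
      isExtended (twistedCorner i b c e f) (i + 2) = xor c e ∧
      isExtended (twistedCorner i b c e f) (i + 3) = xor e f := by
  decide

theorem twistedCorner_injective {i : Fin 4} {b c e f b' c' e' f' : Bool}
    (h : twistedCorner i b c e f = twistedCorner i b' c' e' f') :
    (b, c, e, f) = (b', c', e', f') := by
  have h₀ := congrFun h i
  have h₁ := congrFun h (i + 1)
  have h₂ := congrFun h (i + 2)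
  have h₃ := congrFun h (i + 3)
  simp only [twistedCorner, lt_self_iff_false, decide_false, Nat.succ_eq_add_one, Nat.reduceAdd,
    sub_self, Fin.isValue, cons_val_zero, Bool.bne_not, Bool.false_bne,
    Bool.not_eq_eq_eq_not, Bool.not_not, Fin.add_one_lt_iff, Fin.reduceLast, add_sub_cancel_left,
    cons_val_one, Bool.bne_right_inj, Matrix.cons_val] at h₀ h₁ h₂ h₃
  simp [*]

variable {d : Fin 4 → ℕ} {s : ℕ}

theorem isEndTyping_twistedType {i j : Fin 4} (hd : 3 ≤ d j) :
    IsEndTyping (twistedType (d := d) i j) := by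
  have h := isEndTyping_endType (n := d j) (l := 0) hd
  have hinv : ∀ w, Function.Involutive (Option.map (xor w)) := by
    unfold Function.Involutive
    decide
  refine ⟨(hinv _).surjective.comp h.surjective, fun {x y b} hx hy => ?_⟩
  replace hx := congrArg (Option.map (xor (decide (j < i)))) hx
  replace hy := congrArg (Option.map (xor (decide (j < i)))) hy
  rw [twistedType, hinv] at hx hy
  exact h.eq_of_eq_some hx hy

theorem side_twistedType (i j : Fin 4) (c ext : Bool) :
    side (twistedType (d := d) i j) c ext = side (endType 0) (xor (decide (j < i)) c) ext := by
  have h : ∀ t w c ext, fits (Option.map (xor w) t) c ext = fits t (xor w c) ext := by decide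
  simp only [side, twistedType, h]

theorem block_twistedCorner (i : Fin 4) (b c e f : Bool) :
    block d s (some (0, twistedCorner i b c e f)) i = side (twistedType i i) (!f) (f == b) ∧
    block d s (some (0, twistedCorner i b c e f)) (i + 1) =
      side (twistedType i (i + 1)) b (xor b c) ∧
    block d s (some (0, twistedCorner i b c e f)) (i + 2) =
      side (twistedType i (i + 2)) c (xor c e) ∧
    block d s (some (0, twistedCorner i b c e f)) (i + 3) =
      side (twistedType i (i + 3)) e (xor e f) := by
  simp [block_zero, isExtended_twistedCorner, side_twistedType, twistedCorner]

theorem forall_cyclicEquiv_symm_mem_block {i : Fin 4} {b c e f : Bool} {a : Fin (d i)}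
    {p : Fin (d (i + 1)) × Fin (d (i + 2)) × Fin (d (i + 3))} :
    (∀ j, (cyclicEquiv (fun j => Fin (d j)) i).symm (a, p) j ∈
        block d s (some (0, twistedCorner i b c e f)) j) ↔
      a ∈ side (twistedType i i) (!f) (f == b) ∧
        p ∈ tailBox (twistedType i (i + 1)) (twistedType i (i + 2)) (twistedType i (i + 3))
          b c e f := by
  rw [forall_iff_cyclic i]
  simp only [cyclicEquiv_symm_apply, block_twistedCorner, tailBox, tailFits, cellType, mem_side,
    Set.mem_ofPred_eq, Bool.and_eq_true, and_assoc]

theorem exists_boxVal_eq_cyclicEquiv_symm {X : Fin 4 → Type*} [∀ j, Fintype (X j)]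
    {S : ∀ j, Finset (X j)} [∀ j, Nonempty (S j)] {i : Fin 4} {A : Finset (X i)}
    {B : Finset (X (i + 1))} {C : Finset (X (i + 2))} {D : Finset (X (i + 3))} [Nonempty A]
    [Nonempty B] [Nonempty C] [Nonempty D]
    (h : S i = A ∧ S (i + 1) = B ∧ S (i + 2) = C ∧ S (i + 3) = D) :
    ∃ ψ : A × B × C × D → Box S, (∀ p q, ψ (p - q) = ψ p - ψ q) ∧
      ∀ p, boxVal (ψ p) = (cyclicEquiv X i).symm (p.1, cell p.2) := by
  obtain ⟨rfl, rfl, rfl, rfl⟩ := h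
  refine ⟨(cyclicEquiv (fun j => S j) i).symm, cyclicEquiv_symm_sub (X := fun j => S j) i,
    fun p => ?_⟩
  rw [Equiv.eq_symm_apply, cyclicEquiv_apply]
  simp only [boxVal, cyclicEquiv_symm_apply, cell]

namespace KeepsOrthogonal

variable {K : Matrix (∀ j, Fin (d j)) (∀ j, Fin (d j)) ℂ} [∀ β j, Nonempty (block d s β j)]

theorem outerLayerKernel (hK : KeepsOrthogonal (block d s) K) {i : Fin 4}
    [∀ j, IsEndTyping (twistedType (d := d) i j)]
    {E : Matrix (Fin (d (i + 1)) × Fin (d (i + 2)) × Fin (d (i + 3)))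
      (Fin (d (i + 1)) × Fin (d (i + 2)) × Fin (d (i + 3))) ℂ}
    (hE : K.submatrix (cyclicEquiv _ i).symm (cyclicEquiv _ i).symm =
      (1 : Matrix (Fin (d i)) (Fin (d i)) ℂ) ⊗ₖ E) :
    OuterLayerKernel (twistedType (d := d) i i) (twistedType (d := d) i (i + 1))
      (twistedType (d := d) i (i + 2)) (twistedType (d := d) i (i + 3)) E where
  cross {b c e f b' c' e' f'} hne := by
    obtain ⟨v, u, h⟩ := hK.exists_eq_add (β := some (0, twistedCorner i b c e f))
      (β' := some (0, twistedCorner i b' c' e' f'))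
      fun h => hne (twistedCorner_injective (Prod.ext_iff.1 (Option.some.inj h)).2)
    refine ⟨fun p => v ((cyclicEquiv _ i).symm p), fun p => u ((cyclicEquiv _ i).symm p),
      fun a ha p hp a' ha' q hq => ?_⟩
    rw [← hE]
    exact h _ _ (forall_cyclicEquiv_symm_mem_block.2 ⟨ha, hp⟩)
      (forall_cyclicEquiv_symm_mem_block.2 ⟨ha', hq⟩)
  same b c e f := by
    obtain ⟨k, v, u, h⟩ := hK.exists_eq_convolution_add (some (0, twistedCorner i b c e f))
    obtain ⟨ψ, hψ, hval⟩ := exists_boxVal_eq_cyclicEquiv_symm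
      (block_twistedCorner (d := d) (s := s) i b c e f)
    refine ⟨k ∘ ψ, v ∘ ψ, u ∘ ψ, fun p q => ?_⟩
    simp only [Function.comp_apply, hψ]
    rw [← h, ← hE, submatrix_apply, hval, hval]
  colSum {b c e f p q} hp hq := by
    obtain ⟨a, ha⟩ := nonempty_side (twistedType (d := d) i i) (!f) (f == b)
    have hcol : ∀ r, ∑ z, K z ((cyclicEquiv _ i).symm (a, r)) = ∑ r', E r' r := fun r => by
      rw [← (cyclicEquiv (fun j => Fin (d j)) i).symm.sum_comp]
      simp only [← submatrix_apply K, hE, Fintype.sum_prod_type, kroneckerMap_apply, one_apply]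
      simp
    rw [← hcol, ← hcol]
    exact hK.sum_eq_sum (forall_cyclicEquiv_symm_mem_block.2 ⟨ha, hp⟩)
      (forall_cyclicEquiv_symm_mem_block.2 ⟨ha, hq⟩)

theorem eq_smul_one (hK : KeepsOrthogonal (block d s) K) (hd : ∀ j, 3 ≤ d j) {i : Fin 4}
    (hloc : ActsTriviallyOn i K) : ∃ t : ℂ, K = t • 1 := by
  have (j : Fin 4) : IsEndTyping (twistedType (d := d) i j) := isEndTyping_twistedType (hd j)
  choose x hx using fun j => IsEndTyping.surjective (τ := twistedType (d := d) i j) none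
  have : Nonempty (Fin (d i)) := ⟨x i⟩
  obtain ⟨E, hE⟩ := (hloc.sub_smul_one (K x x)).exists_eq_one_kronecker
  have hm₀ : E (x (i + 1), x (i + 2), x (i + 3)) (x (i + 1), x (i + 2), x (i + 3)) = 0 := by
    have h := congrFun₂ hE (cyclicEquiv _ i x) (cyclicEquiv _ i x)
    rw [submatrix_apply, Equiv.symm_apply_apply, cyclicEquiv_apply, kroneckerMap_apply] at h
    simpa using h.symm
  have hE₀ : E = 0 := ((hK.sub_smul_one (isBoxPartition_block d s) _).outerLayerKernel hE).eq_zero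
    (by simp only [cellType, hx]) hm₀
  refine ⟨K x x, sub_eq_zero.1 (Matrix.ext fun y z => ?_)⟩
  have h := congrFun₂ hE (cyclicEquiv _ i y) (cyclicEquiv _ i z)
  simpa [hE₀] using h

end KeepsOrthogonal

end Rotation

section LocalOperators

variable {ι : Type} [Fintype ι] [DecidableEq ι] {d : ι → ℕ} {P : Finset ι}

/-- The matrix of `M ⊗ 𝟙`, where `M` acts on the parties in `P`. -/
def localMatrix (M : GroupOp d P) : Matrix (∀ i, Fin (d i)) (∀ i, Fin (d i)) ℂ :=
  (M ⊗ₖ (1 : Matrix (∀ i : {i // i ∉ P}, Fin (d i)) (∀ i : {i // i ∉ P}, Fin (d i)) ℂ)).submatrix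
    (Equiv.piEquivPiSubtypeProd (· ∈ P) _) (Equiv.piEquivPiSubtypeProd (· ∈ P) _)

theorem localMatrix_apply (M : GroupOp d P) (x y : ∀ i, Fin (d i)) :
    localMatrix M x y =
      if ∀ i ∉ P, x i = y i then M (fun i => x i) (fun i => y i) else 0 := by
  have h : (fun i : {i // i ∉ P} => x i) = (fun i : {i // i ∉ P} => y i) ↔ ∀ i ∉ P, x i = y i := by
    rw [funext_iff, Subtype.forall]
  simp [localMatrix, one_apply, Equiv.piEquivPiSubtypeProd, h]

theorem actsTriviallyOn_localMatrix (M : GroupOp d P) {i : ι} (hi : i ∉ P) :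
    ActsTriviallyOn i (localMatrix M) where
  eq_zero h := by rw [localMatrix_apply, if_neg fun h' => h (h' i hi)]
  update {x y} a h := by
    have hP (w : ∀ j, Fin (d j)) (j : {j // j ∈ P}) : Function.update w i a j = w j :=
      Function.update_of_ne (ne_of_mem_of_not_mem j.2 hi) _ _
    have hPc : (∀ j ∉ P, Function.update x i a j = Function.update y i a j) ↔
        ∀ j ∉ P, x j = y j := by
      refine forall₂_congr fun j _ => ?_
      obtain rfl | hj := eq_or_ne j i
      · simp [h]
      · simp [hj]
    simp only [localMatrix_apply, hP, hPc]

theorem ofLp_applyOn (M : GroupOp d P) (ψ : MState d) :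
    (applyOn M ψ).ofLp = localMatrix M *ᵥ ψ.ofLp := by
  ext x
  rw [mulVec, dotProduct, ← (Equiv.piEquivPiSubtypeProd (· ∈ P) _).symm.sum_comp,
    Fintype.sum_prod_type]
  simp only [localMatrix, submatrix_apply, Equiv.apply_symm_apply, kroneckerMap_apply, one_apply]
  simp [applyOn, Equiv.piEquivPiSubtypeProd]

theorem localMatrix_one : localMatrix (1 : GroupOp d P) = 1 := by
  rw [localMatrix, one_kronecker_one, submatrix_one_equiv]

theorem localMatrix_smul (c : ℂ) (M : GroupOp d P) :
    localMatrix (c • M) = c • localMatrix M := by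
  rw [localMatrix, smul_kronecker, submatrix_smul]
  rfl

theorem localMatrix_mul (M N : GroupOp d P) :
    localMatrix (M * N) = localMatrix M * localMatrix N := by
  rw [localMatrix, localMatrix, localMatrix, submatrix_mul_equiv, ← mul_kronecker_mul, one_mul]

theorem localMatrix_conjTranspose (M : GroupOp d P) :
    localMatrix Mᴴ = (localMatrix M)ᴴ := by
  rw [localMatrix, localMatrix, conjTranspose_submatrix, conjTranspose_kronecker, conjTranspose_one]

theorem localMatrix_injective [∀ i, Nonempty (Fin (d i))] :
    Function.Injective (localMatrix : GroupOp d P → _) := by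
  intro M N h
  ext y y'
  have := congrFun₂ h
    ((Equiv.piEquivPiSubtypeProd (· ∈ P) _).symm (y, fun _ => Classical.arbitrary _))
    ((Equiv.piEquivPiSubtypeProd (· ∈ P) _).symm (y', fun _ => Classical.arbitrary _))
  simpa [localMatrix] using this

theorem applyOn_applyOn (N M : GroupOp d P) (ψ : MState d) :
    applyOn N (applyOn M ψ) = applyOn (N * M) ψ := by
  apply WithLp.ofLp_injective
  simp only [ofLp_applyOn, localMatrix_mul, mulVec_mulVec]

theorem inner_applyOn (M : GroupOp d P) (ψ φ : MState d) :
    inner ℂ (applyOn M ψ) (applyOn M φ) = star ψ.ofLp ⬝ᵥ localMatrix (Mᴴ * M) *ᵥ φ.ofLp := by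
  rw [EuclideanSpace.inner_eq_star_dotProduct, dotProduct_comm, ofLp_applyOn, ofLp_applyOn,
    star_mulVec, dotProduct_mulVec, vecMul_vecMul, ← dotProduct_mulVec,
    ← localMatrix_conjTranspose, ← localMatrix_mul]

theorem inner_applyOn_of_scalar {M : GroupOp d P} {c : ℂ} (hM : Mᴴ * M = c • 1)
    (ψ φ : MState d) : inner ℂ (applyOn M ψ) (applyOn M φ) = c * inner ℂ ψ φ := by
  rw [inner_applyOn, hM, localMatrix_smul, localMatrix_one, smul_mulVec, one_mulVec,
    dotProduct_smul, smul_eq_mul, EuclideanSpace.inner_eq_star_dotProduct, dotProduct_comm]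

theorem applyOn_eq_zero_iff_of_scalar {M : GroupOp d P} {c : ℂ} (hM : Mᴴ * M = c • 1)
    {ψ : MState d} : applyOn M ψ = 0 ↔ c = 0 ∨ ψ = 0 := by
  rw [← inner_self_eq_zero (𝕜 := ℂ), inner_applyOn_of_scalar hM, mul_eq_zero, inner_self_eq_zero]

theorem applyOn_comm {P' : Finset ι} (hP : Disjoint P P') (M : GroupOp d P) (N : GroupOp d P')
    (ψ : MState d) : applyOn M (applyOn N ψ) = applyOn N (applyOn M ψ) := by
  have hd {i} (h : i ∈ P) : i ∉ P' := Finset.disjoint_left.1 hP h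
  ext x
  simp only [applyOn, Finset.mul_sum]
  rw [Finset.sum_comm]
  refine Finset.sum_congr rfl fun y' _ => Finset.sum_congr rfl fun y _ => ?_
  have hP' : (fun i : {i // i ∈ P'} => if h : (i : ι) ∈ P then y ⟨i, h⟩ else x i) =
      fun i : {i // i ∈ P'} => x i := funext fun i => dif_neg fun h => hd h i.2
  have hP : (fun i : {i // i ∈ P} => if h : (i : ι) ∈ P' then y' ⟨i, h⟩ else x i) =
      fun i : {i // i ∈ P} => x i := funext fun i => dif_neg (hd i.2)
  have hswap : (fun i => if h : i ∈ P' then y' ⟨i, h⟩ else if h : i ∈ P then y ⟨i, h⟩ else x i) =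
      fun i => if h : i ∈ P then y ⟨i, h⟩ else if h : i ∈ P' then y' ⟨i, h⟩ else x i := by
    funext i
    by_cases h : i ∈ P
    · simp [h, hd h]
    · simp [h]
  rw [hP', hP, hswap, mul_left_comm]

end LocalOperators

section Rigidity

theorem exists_eq_smul_one_of_conjTranspose_mul_mul {n : Type*} [Fintype n] [DecidableEq n]
    {M A : Matrix n n ℂ} {c c' : ℂ} (hc : c ≠ 0) (hM : Mᴴ * M = c • 1)
    (hA : Mᴴ * A * M = c' • 1) : ∃ t : ℂ, A = t • 1 := by
  have hinv : M * (c⁻¹ • Mᴴ) = 1 := mul_eq_one_comm.1 <| by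
    rw [Matrix.smul_mul, hM, inv_smul_smul₀ hc]
  have hinv' : (c⁻¹ • M) * Mᴴ = 1 := by rwa [Matrix.smul_mul, ← Matrix.mul_smul]
  refine ⟨c⁻¹ * c', ?_⟩
  calc A = (c⁻¹ • M) * Mᴴ * A * (M * (c⁻¹ • Mᴴ)) := by rw [hinv, hinv', one_mul, mul_one]
    _ = (c⁻¹ • M) * (Mᴴ * A * M) * (c⁻¹ • Mᴴ) := by simp only [Matrix.mul_assoc]
    _ = (c⁻¹ * c') • (M * (c⁻¹ • Mᴴ)) := by
      simp only [hA, Matrix.mul_smul, Matrix.smul_mul, Matrix.mul_one, smul_smul]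
      ring_nf
    _ = (c⁻¹ * c') • 1 := by rw [hinv]

variable {ι κ : Type} [Fintype ι] [DecidableEq ι] {d : ι → ℕ} {T P : Finset ι} {ψ : κ → MState d}

/-- Every operator of one of the two sides of `T | Tᶜ` which keeps the states `ψ i` orthogonal is a
multiple of an isometry. -/
def IsRigid (T : Finset ι) (ψ : κ → MState d) : Prop :=
  ∀ P : Finset ι, P = T ∨ P = Tᶜ → ∀ N : GroupOp d P,
    (∀ i j, i ≠ j → inner ℂ (applyOn N (ψ i)) (applyOn N (ψ j)) = 0) → ∃ c : ℂ, Nᴴ * N = c • 1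

theorem disjoint_of_ne_of_eq_or_eq_compl {P' : Finset ι} (hP : P = T ∨ P = Tᶜ)
    (hP' : P' = T ∨ P' = Tᶜ) (hne : P' ≠ P) : Disjoint P P' := by
  obtain rfl | rfl := hP <;> obtain rfl | rfl := hP'
  · exact absurd rfl hne
  · exact disjoint_compl_right
  · exact disjoint_compl_left
  · exact absurd rfl hne

namespace IsRigid

theorem applyOn (h : IsRigid T ψ) (hP : P = T ∨ P = Tᶜ) {M : GroupOp d P} {c : ℂ} (hc : c ≠ 0)
    (hM : Mᴴ * M = c • 1) : IsRigid T fun i => applyOn M (ψ i) := by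
  intro P' hP' N hN
  obtain rfl | hne := eq_or_ne P' P
  · obtain ⟨c', hc'⟩ := h P' hP' (N * M) fun i j hij => by
      simpa only [applyOn_applyOn] using hN i j hij
    refine exists_eq_smul_one_of_conjTranspose_mul_mul hc hM (c' := c') ?_
    rw [← hc', conjTranspose_mul]
    simp only [Matrix.mul_assoc]
  · refine h P' hP' N fun i j hij => ?_
    have hcomm := applyOn_comm (disjoint_of_ne_of_eq_or_eq_compl hP hP' hne) M N
    have := hN i j hij
    rw [← hcomm, ← hcomm, inner_applyOn_of_scalar hM, mul_eq_zero] at this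
    exact this.resolve_left hc

theorem not_canEliminate (h : IsRigid T ψ) (h₀ : ∀ i, ψ i ≠ 0) : ¬ CanEliminate T ψ := by
  intro hE
  induction hE with
  | now P hP M _ hO k i j hi hj =>
    obtain ⟨c, hc⟩ := h P hP (M k) (hO k)
    rw [applyOn_eq_zero_iff_of_scalar hc] at hi
    exact hj ((applyOn_eq_zero_iff_of_scalar hc).2 (.inl (hi.resolve_right (h₀ i))))
  | later P hP M _ hO k j hj _ ih =>
    obtain ⟨c, hc⟩ := h P hP (M k) (hO k)
    have hc₀ : c ≠ 0 := fun h => hj ((applyOn_eq_zero_iff_of_scalar hc).2 (.inl h))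
    refine ih (h.applyOn hP hc₀ hc) fun i hi => ?_
    exact ((applyOn_eq_zero_iff_of_scalar hc).1 hi).elim hc₀ (h₀ i)

end IsRigid

end Rigidity

section LinkedFactors

theorem eq_of_prod_update_eq {ι : Type*} [Fintype ι] [DecidableEq ι] {X : ι → Type*}
    {v : ∀ j, X j → ℂ} {x : ∀ j, X j} (hx : ∀ j, v j (x j) ≠ 0) {i : ι} {p q : X i}
    (h : ∏ j, v j (Function.update x i p j) = ∏ j, v j (Function.update x i q j)) :
    v i p = v i q := by
  have hprod (p : X i) :
      ∏ j, v j (Function.update x i p j) = v i p * ∏ j ∈ univ.erase i, v j (x j) := by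
    rw [← Finset.mul_prod_erase _ _ (mem_univ i), Function.update_self]
    congr 1
    refine Finset.prod_congr rfl fun j hj => ?_
    rw [Function.update_of_ne (Finset.ne_of_mem_erase hj)]
  rw [hprod, hprod] at h
  exact mul_right_cancel₀ (Finset.prod_ne_zero_iff.2 fun j _ => hx j) h

theorem forall_of_cyclic {p : Fin 4 → Prop} (h : ∀ i, p (i + 1) → p i) {i : Fin 4} (hi : p i) :
    ∀ j, p j := by
  have hcycle : i + 3 + 1 = i := by clear hi; revert i; decide
  have h₃ : p (i + 3) := h _ (by rwa [hcycle])
  have h₂ : p (i + 2) := h _ (by rwa [add_assoc])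
  exact (forall_iff_cyclic i).2 ⟨hi, h _ (by rwa [add_assoc]), h₂, h₃⟩

/-- The factors `v j` of a product function which is constant on the blocks of a layer and lives in
the box enclosed by this layer, with ends `E j b` and interior points `I j`: a nonzero value of the
next factor at an end `b` links an end of the `i`-th line to the interior. -/
structure LinkedFactors {X : Fin 4 → Type*} (E : ∀ j, Bool → X j) (I : ∀ j, Set (X j))
    (σ : Fin 4 → Bool → Bool) (v : ∀ j, X j → ℂ) : Prop where
  surjective : ∀ i, Function.Surjective (σ i)
  nonempty : ∀ i, (I i).Nonempty
  ne_zero : ∀ i, v i ≠ 0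
  eq_or_mem : ∀ {i x}, v i x ≠ 0 → (∃ b, x = E i b) ∨ x ∈ I i
  link : ∀ {i b x}, v (i + 1) (E (i + 1) b) ≠ 0 → x ∈ I i → v i x = v i (E i (σ i b))

namespace LinkedFactors

variable {X : Fin 4 → Type*} {E : ∀ j, Bool → X j} {I : ∀ j, Set (X j)}
  {σ : Fin 4 → Bool → Bool} {v : ∀ j, X j → ℂ} {i : Fin 4}

theorem exists_end_ne_zero (h : LinkedFactors E I σ v)
    (hi : ∃ b, v (i + 1) (E (i + 1) b) ≠ 0) : ∃ b, v i (E i b) ≠ 0 := by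
  obtain ⟨b, hb⟩ := hi
  obtain ⟨x, hx⟩ := Function.ne_iff.1 (h.ne_zero i)
  obtain ⟨b', rfl⟩ | hxI := h.eq_or_mem hx
  · exact ⟨b', hx⟩
  · exact ⟨_, h.link hb hxI ▸ hx⟩

theorem exists_forall_eq (h : LinkedFactors E I σ v)
    (hi : ∀ b, v (i + 1) (E (i + 1) b) ≠ 0) :
    ∃ k, (∀ b, v i (E i b) = k) ∧ ∀ x, v i x ≠ 0 → v i x = k := by
  obtain ⟨m, hm⟩ := h.nonempty i
  have hend (b' : Bool) : v i (E i b') = v i m := by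
    obtain ⟨b, rfl⟩ := h.surjective i b'
    exact (h.link (hi b) hm).symm
  refine ⟨v i m, hend, fun x hx => ?_⟩
  obtain ⟨b, rfl⟩ | hxI := h.eq_or_mem hx
  · exact hend b
  · exact (h.link (hi true) hxI).trans (hend _)

theorem forall_end_ne_zero (h : LinkedFactors E I σ v)
    (hi : ∀ b, v (i + 1) (E (i + 1) b) ≠ 0) (b : Bool) : v i (E i b) ≠ 0 := by
  obtain ⟨k, hk, hconst⟩ := h.exists_forall_eq hi
  obtain ⟨x, hx⟩ := Function.ne_iff.1 (h.ne_zero i)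
  rwa [hk, ← hconst x hx]

variable [∀ j, Fintype (X j)]

theorem sum_ne_zero_of_end_eq_zero (h : LinkedFactors E I σ v)
    (hi : ∃ b, v (i + 1) (E (i + 1) b) ≠ 0) (hi' : ∃ b, v i (E i b) = 0) :
    ∑ x, v i x ≠ 0 := by
  obtain ⟨b, hb⟩ := hi
  obtain ⟨e, he⟩ := hi'
  have hcase (b' : Bool) : b' = e ∨ b' = !e := by cases b' <;> cases e <;> simp
  refine sum_ne_zero_of_const (k := v i (E i !e)) (h.ne_zero i) fun x hx => ?_
  obtain ⟨b', rfl⟩ | hxI := h.eq_or_mem hx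
  · obtain rfl | rfl := hcase b'
    · exact absurd he hx
    · rfl
  · rw [h.link hb hxI] at hx ⊢
    obtain hσ | hσ := hcase (σ i b)
    · exact absurd (hσ ▸ he) hx
    · rw [hσ]

theorem sum_ne_zero (h : LinkedFactors E I σ v) (hi : ∃ b, v i (E i b) ≠ 0) (j : Fin 4) :
    ∑ x, v j x ≠ 0 := by
  by_cases hall : ∃ i, ∀ b, v i (E i b) ≠ 0
  · obtain ⟨i', hi'⟩ := hall
    have hends := forall_of_cyclic (p := fun i => ∀ b, v i (E i b) ≠ 0)
      (fun _ => h.forall_end_ne_zero) hi'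
    obtain ⟨k, -, hconst⟩ := h.exists_forall_eq (hends (j + 1))
    exact sum_ne_zero_of_const (h.ne_zero j) hconst
  · push Not at hall
    have hends := forall_of_cyclic (p := fun i => ∃ b, v i (E i b) ≠ 0)
      (fun _ => h.exists_end_ne_zero) hi
    exact h.sum_ne_zero_of_end_eq_zero (hends (j + 1)) (hall j)

end LinkedFactors

end LinkedFactors

section Unextendible

variable {d : Fin 4 → ℕ} {s : ℕ}

theorem depth_of_endType_eq_some {n l : ℕ} {x : Fin n} {b : Bool} (hn : 2 * l + 1 < n)
    (hx : endType l x = some b) : depth x = l := by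
  rw [endType_eq_some hn] at hx
  unfold depth
  split_ifs at hx <;> omega

theorem endType_eq_none_of_lt {n l : ℕ} {x : Fin n} (hx : l < depth x) : endType l x = none :=
  not_not.1 fun h => hx.ne' ((endType_ne_none hx.le).1 h)

/-- The end of the `i`-th line whose block with a given end `b` of the next line extends in
direction `i`. -/
def linkedEnd (i : Fin 4) (b : Bool) : Bool := !(xor b (i == 3))

theorem surjective_linkedEnd (i : Fin 4) : Function.Surjective (linkedEnd i) := fun b =>
  ⟨linkedEnd i b, by revert i b; decide⟩

theorem isExtended_of_eq_linkedEnd {c : Fin 4 → Bool} {i : Fin 4}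
    (h : c i = linkedEnd i (c (i + 1))) : isExtended c i = true := by
  rw [isExtended, h, linkedEnd]
  cases c (i + 1) <;> cases (i == 3) <;> rfl

/-- The product function with factors `v j` is constant on every block. -/
def ProdConstOnBlocks (s : ℕ) (v : ∀ j, Fin (d j) → ℂ) : Prop :=
  ∀ ⦃β : BlockLabel s⦄ ⦃x y : ∀ j, Fin (d j)⦄,
    (∀ j, x j ∈ block d s β j) → (∀ j, y j ∈ block d s β j) → ∏ j, v j (x j) = ∏ j, v j (y j)

namespace ProdConstOnBlocks

variable {v : ∀ j, Fin (d j) → ℂ}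

theorem eq_of_endType (hv : ProdConstOnBlocks s v) {l : Fin (s + 1)} {x : ∀ j, Fin (d j)}
    (hx : ∀ j, v j (x j) ≠ 0) (hle : ∀ j, l ≤ depth (x j)) {i : Fin 4} {b : Bool}
    (hb : endType l (x (i + 1)) = some b) {p q : Fin (d i)}
    (hp : endType l p = some (linkedEnd i b)) (hpl : depth p = l) (hql : l < depth q) :
    v i q = v i p := by
  have hle' {r : Fin (d i)} (hr : l ≤ depth r) (j : Fin 4) :
      l ≤ depth (Function.update x i r j) := by
    obtain rfl | hj := eq_or_ne j i
    · rwa [Function.update_self]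
    · rw [Function.update_of_ne hj]
      exact hle j
  obtain ⟨c, hc, -⟩ := existsUnique_block_some l (hle' hpl.ge) ⟨i, by rwa [Function.update_self]⟩
  have hfits := (forall_mem_block_some.1 hc).1
  have hcorner {j : Fin 4} {e : Bool} (he : endType l (Function.update x i p j) = some e) :
      e = c j := by
    simpa [fits, he] using hfits j
  have hext : isExtended c i = true := isExtended_of_eq_linkedEnd <| by
    rw [← hcorner (j := i) (by rwa [Function.update_self]),
      ← hcorner (j := i + 1) (by rwa [Function.update_of_ne (cyclic_ne i).1])]
  refine eq_of_prod_update_eq hx (hv (β := some (l, c))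
    (forall_mem_block_some.2 ⟨fun j => ?_, hle' hql.le⟩) hc)
  obtain rfl | hj := eq_or_ne j i
  · rw [Function.update_self, endType_eq_none_of_lt hql, hext]
    rfl
  · rw [Function.update_of_ne hj]
    simpa [hj] using hfits j

theorem exists_linkedFactors (hv : ProdConstOnBlocks s v) (hd : ∀ j, 2 * s + 3 ≤ d j)
    (h₀ : ∀ j, v j ≠ 0) (l : Fin (s + 1)) (hle : ∀ {j x}, v j x ≠ 0 → l ≤ depth x) :
    ∃ E : ∀ j, Bool → Fin (d j), (∀ {j b x}, endType l x = some b → x = E j b) ∧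
      LinkedFactors E (fun _ => {x | l < depth x}) linkedEnd v := by
  have hdl (j : Fin 4) : 2 * (l : ℕ) + 3 ≤ d j := by have := hd j; omega
  have htyping (j : Fin 4) := isEndTyping_endType (hdl j)
  choose E hE using fun j b => (htyping j).surjective (some b)
  have heq {j b x} (hx : endType l x = some b) : x = E j b := (htyping j).eq_of_eq_some hx (hE j b)
  choose x₀ hx₀ using fun j => Function.ne_iff.1 (h₀ j)
  refine ⟨E, heq, surjective_linkedEnd, fun j => ?_, h₀, fun {j x} hx => ?_,
    fun {i b q} hb hq => ?_⟩
  · obtain ⟨m, hm⟩ := nonempty_block hd none j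
    simp only [block, mem_filter, mem_univ, true_and] at hm
    exact ⟨m, lt_of_le_of_lt (Nat.le_of_lt_succ l.2) hm⟩
  · cases ht : endType l x with
    | none => exact .inr ((hle hx).lt_of_ne' fun h => (endType_ne_none (hle hx)).2 h ht)
    | some b => exact .inl ⟨b, heq ht⟩
  · have hx (j : Fin 4) : v j (Function.update x₀ (i + 1) (E (i + 1) b) j) ≠ 0 := by
      obtain rfl | hj := eq_or_ne j (i + 1)
      · rwa [Function.update_self]
      · rw [Function.update_of_ne hj]
        exact hx₀ j
    have hlt : 2 * (l : ℕ) + 1 < d i := by have := hdl i; omega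
    exact hv.eq_of_endType hx (fun j => hle (hx j)) (by rw [Function.update_self, hE]) (hE i _)
      (depth_of_endType_eq_some hlt (hE i _)) hq

theorem sum_ne_zero_of_forall_lt_depth (hv : ProdConstOnBlocks s v) (h₀ : ∀ j, v j ≠ 0)
    (hlt : ∀ {j x}, v j x ≠ 0 → s < depth x) (j : Fin 4) : ∑ x, v j x ≠ 0 := by
  choose x₀ hx₀ using fun j => Function.ne_iff.1 (h₀ j)
  have hmem {r : Fin (d j)} (hr : v j r ≠ 0) :
      ∀ i, Function.update x₀ j r i ∈ block d s none i := by
    refine forall_mem_block_none.2 fun i => ?_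
    obtain rfl | hi := eq_or_ne i j
    · rw [Function.update_self]
      exact hlt hr
    · rw [Function.update_of_ne hi]
      exact hlt (hx₀ i)
  exact sum_ne_zero_of_const (h₀ j) fun x hx =>
    eq_of_prod_update_eq hx₀ (hv (hmem hx) (hmem (hx₀ j)))

theorem sum_ne_zero (hv : ProdConstOnBlocks s v) (hd : ∀ j, 2 * s + 3 ≤ d j) (h₀ : ∀ j, v j ≠ 0)
    (j : Fin 4) : ∑ x, v j x ≠ 0 := by
  have : Nonempty (Σ j, {x // v j x ≠ 0}) :=
    let ⟨x, hx⟩ := Function.ne_iff.1 (h₀ 0)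
    ⟨⟨0, x, hx⟩⟩
  obtain ⟨⟨i, x, hx⟩, hmin⟩ := Finite.exists_min fun p : Σ j, {x // v j x ≠ 0} => depth p.2.1
  obtain hs | hs := lt_or_ge s (depth x)
  · exact hv.sum_ne_zero_of_forall_lt_depth h₀ (fun hy => hs.trans_le (hmin ⟨_, _, hy⟩)) j
  · obtain ⟨E, hE, hlink⟩ := hv.exists_linkedFactors hd h₀ ⟨depth x, Nat.lt_succ_of_le hs⟩
      fun hy => hmin ⟨_, _, hy⟩
    obtain ⟨b, hb⟩ := Option.ne_none_iff_exists'.1 ((endType_ne_none le_rfl).2 (Eq.refl (depth x)))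
    exact hlink.sum_ne_zero ⟨b, hE hb ▸ hx⟩ j

end ProdConstOnBlocks

end Unextendible

section LayerBasis

variable {d : Fin 4 → ℕ} {s : ℕ} [∀ β j, Nonempty (block d s β j)]

/-- The states of the layered box partition, as vectors of the four-partite system. -/
noncomputable def layerState (d : Fin 4 → ℕ) (s : ℕ) [∀ β j, Nonempty (block d s β j)]
    (l : StateLabel (block d s)) : MState d :=
  WithLp.toLp 2 (boxState (block d s) l)

theorem keepsOrthogonal_localMatrix {P : Finset (Fin 4)} {N : GroupOp d P}
    (hN : ∀ l l', l ≠ l' →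
      inner ℂ (applyOn N (layerState d s l)) (applyOn N (layerState d s l')) = 0) :
    KeepsOrthogonal (block d s) (localMatrix (Nᴴ * N)) := fun l l' h => by
  rw [← hN l l' h, inner_applyOn]
  rfl

theorem isRigid_layerState (hd : ∀ j, 3 ≤ d j) {T : Finset (Fin 4)} (hT : T.Nonempty)
    (hTc : Tᶜ.Nonempty) : IsRigid T (layerState d s) := by
  intro P hP N hN
  obtain ⟨i, hi⟩ : ∃ i, i ∉ P := by
    obtain rfl | rfl := hP
    · exact hTc.imp fun i => Finset.mem_compl.1
    · exact hT.imp fun i h => by simpa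
  obtain ⟨t, ht⟩ := (keepsOrthogonal_localMatrix hN).eq_smul_one hd
    (actsTriviallyOn_localMatrix _ hi)
  have (j : Fin 4) : Nonempty (Fin (d j)) := ⟨0, by linarith [hd j]⟩
  exact ⟨t, localMatrix_injective (by rw [ht, localMatrix_smul, localMatrix_one])⟩

theorem inner_layerState (l : StateLabel (block d s)) (φ : MState d) :
    inner ℂ (layerState d s l) φ = star (boxState (block d s) l) ⬝ᵥ φ.ofLp := by
  rw [EuclideanSpace.inner_eq_star_dotProduct, dotProduct_comm]
  rfl

theorem not_isProductState_of_forall_inner_layerState (hd : ∀ j, 2 * s + 3 ≤ d j) {φ : MState d}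
    (hφ : ∀ l, inner ℂ (layerState d s l) φ = 0) : ¬ IsProductState φ := by
  rintro ⟨hne, v, hprod⟩
  simp only [inner_layerState] at hφ
  have hv : ProdConstOnBlocks s fun j => (v j).ofLp := fun β x y hx hy => by
    rw [← hprod, ← hprod]
    exact const_of_forall_star_boxState_dotProduct hφ hx hy
  obtain ⟨x₀, hx₀⟩ : ∃ x, φ x ≠ 0 := by
    by_contra! h
    exact hne (by ext x; exact h x)
  rw [hprod, Finset.prod_ne_zero_iff] at hx₀
  have hv₀ (j : Fin 4) : (v j).ofLp ≠ 0 := fun h => hx₀ j (mem_univ j) (congrFun h _)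
  have hstopper := hφ none
  simp only [boxState, star_one, one_dotProduct, hprod] at hstopper
  rw [← Fintype.prod_sum fun j x => v j x] at hstopper
  exact Finset.prod_ne_zero_iff.2 (fun j _ => hv.sum_ne_zero hd hv₀ j) hstopper

/-- The unextendible product basis: the set of the states of the layered box partition. -/
noncomputable def layerBasis (d : Fin 4 → ℕ) (s : ℕ) [∀ β j, Nonempty (block d s β j)] :
    Finset (MState d) := by
  classical exact univ.image (layerState d s)

theorem mem_layerBasis {ψ : MState d} : ψ ∈ layerBasis d s ↔ ∃ l, layerState d s l = ψ := by
  simp [layerBasis]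

variable [∀ j, Nonempty (Fin (d j))]

theorem layerState_injective : Function.Injective (layerState d s) :=
  (WithLp.toLp_injective 2).comp (boxState_injective (isBoxPartition_block d s))

theorem isProductState_layerState (l : StateLabel (block d s)) :
    IsProductState (layerState d s l) := by
  obtain ⟨v, hv⟩ := exists_boxState_eq_prod l
  exact ⟨fun h => boxState_ne_zero l (congrArg WithLp.ofLp h), fun j => WithLp.toLp 2 (v j), hv⟩

theorem card_layerBasis : #(layerBasis d s) + 16 * (s + 1) = ∏ j, d j := by
  have h := card_stateLabel_add_card (isBoxPartition_block d s)
  have hlabel : Fintype.card (BlockLabel s) = 16 * (s + 1) + 1 := by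
    simp [BlockLabel, mul_comm]
  rw [layerBasis, Finset.card_image_of_injective _ layerState_injective, Finset.card_univ,
    ← Nat.card_eq_fintype_card]
  simp only [hlabel, Fintype.card_fin] at h
  omega

theorem isOPS_layerBasis : IsOPS (layerBasis d s) := by
  refine ⟨fun ψ hψ => ?_, fun ψ hψ φ hφ hne => ?_⟩
  · obtain ⟨l, rfl⟩ := mem_layerBasis.1 hψ
    exact isProductState_layerState l
  · obtain ⟨l, rfl⟩ := mem_layerBasis.1 hψ
    obtain ⟨l', rfl⟩ := mem_layerBasis.1 hφ
    rw [inner_layerState]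
    exact star_boxState_dotProduct (isBoxPartition_block d s) (ne_of_apply_ne _ hne)

theorem span_layerBasis_ne_top : Submodule.span ℂ (layerBasis d s : Set (MState d)) ≠ ⊤ := by
  intro htop
  have h := finrank_span_finset_le_card (R := ℂ) (layerBasis d s)
  rw [Set.finrank, htop, finrank_top, finrank_euclideanSpace, Fintype.card_pi] at h
  simp only [Fintype.card_fin, ← card_layerBasis (s := s)] at h
  omega

theorem isUPB_layerBasis (hd : ∀ j, 2 * s + 3 ≤ d j) : IsUPB (layerBasis d s) := by
  refine ⟨isOPS_layerBasis, span_layerBasis_ne_top, fun φ hφ => ?_⟩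
  refine not_isProductState_of_forall_inner_layerState hd fun l => ?_
  exact (Submodule.mem_orthogonal _ _).1 hφ _ (Submodule.subset_span (mem_layerBasis.2 ⟨l, rfl⟩))

theorem isStronglyNonlocal_layerBasis (hd : ∀ j, 3 ≤ d j) :
    IsStronglyNonlocal (layerBasis d s) := by
  intro T hT hTc
  refine IsRigid.not_canEliminate (fun P hP N hN => ?_) fun ψ => (isOPS_layerBasis.1 _ ψ.2).1
  refine isRigid_layerState (s := s) hd hT hTc P hP N fun l l' h => ?_
  exact hN ⟨_, mem_layerBasis.2 ⟨l, rfl⟩⟩ ⟨_, mem_layerBasis.2 ⟨l', rfl⟩⟩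
    fun h' => h (layerState_injective (congrArg Subtype.val h'))

end LayerBasis

theorem theorem3_general (d : Fin 4 → ℕ) (s : ℕ) (hd : ∀ j, 2 * s + 3 ≤ d j) :
    ∃ U : Finset (MState d),
      IsUPB U ∧ IsStronglyNonlocal U ∧
        (U.card : ℤ) = (d 0 : ℤ) * d 1 * d 2 * d 3 - 16 * (s + 1) := by
  have := nonempty_block hd
  have hd₃ (j : Fin 4) : 3 ≤ d j := by have := hd j; omega
  have (j : Fin 4) : Nonempty (Fin (d j)) := ⟨0, by have := hd₃ j; omega⟩
  refine ⟨layerBasis d s, isUPB_layerBasis hd, isStronglyNonlocal_layerBasis hd₃, ?_⟩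
  have hcard := card_layerBasis (d := d) (s := s)
  rw [Fin.prod_univ_four] at hcard
  zify at hcard
  linarith

theorem theorem3 (d : Fin 4 → ℕ) (hA : 3 ≤ d 0) (hAB : d 0 ≤ d 1) (hBC : d 1 ≤ d 2)
    (hCD : d 2 ≤ d 3) (s : ℕ) (hs : s ≤ (d 0 - 3) / 2) :
    ∃ U : Finset (MState d),
      IsUPB U ∧ IsStronglyNonlocal U ∧
        (U.card : ℤ) = (d 0 : ℤ) * d 1 * d 2 * d 3 - 16 * (s + 1) :=
  theorem3_general d s fun | 0 | 1 | 2 | 3 => by omega
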